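/- Let $b$ be a prime power, let $D\ge 0$ be an integer, and let $U$ be a finite-dimensional vector space over the finite field $\mathbb F_b$ endowed with one of the following nondegenerate forms: - $C_D(b)$: $\dim U=2D$, symplectic form, $e=1$; - $B_D(b)$: $\dim U=2D+1$, quadratic form, $e=1$; - $D_D(b)$: $\dim U=2D$, quadratic form of Witt index $D$, $e=0$; - ${}^2D_{D+1}(b)$: $\dim U=2D+2$, quadratic form of Witt index $D$, $e=2$; - ${}^2A_{2D}(q)$: $\dim U=2D+1$, Hermitian form, $b=q^2$, $e=3/2$; - ${}^2A_{2D-1}(q)$: $\dim U=2D$, Hermitian form, $b=q^2$, $e=1/2$. Let $q\in\mathbb C$ satisfy $q^2=b$; in the two Hermitian cases $q$ is the positive integer with $q^2=b$. A subspace of $U$ is isotropic if the form vanishes completely on it; the maximal isotropic subspaces all have dimension $D$. Let $\Gamma$ be the dual polar graph: its vertex set $X$ is the set of maximal isotropic subspaces of $U$, and $y,z\in X$ are adjacent if and only if $\dim(y\cap z)=D-1$. Let $\partial$ be the path-length distance of $\Gamma$ and fix $x\in X$. Define $L,F,R\in\mathrm{Mat}_X(\mathbb C)$ (the lowering, flattening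 and raising matrices with respect to $x$) as follows: the $(y,z)$-entry of $L$ (resp. $F$, resp. $R$) is $1$ if $y,z$ are adjacent and $\partial(x,z)-\partial(x,y)$ equals $1$ (resp. $0$, resp. $-1$), and is $0$ otherwise. For $0\le i\le D$ let $E_i^*$ be the diagonal matrix whose $(y,y)$-entry is $1$ if $\partial(x,y)=i$ and $0$ otherwise, and let $K=\sum_{i=0}^D q^{-2i}E_i^*$. Then $$KL=q^2LK,\qquad KF=FK,\qquad KR=q^{-2}RK,$$ $$LF-q^2FL=(q^{2e}-1)L,\qquad FR-q^2RF=(q^{2e}-1)R,$$ $$\frac{q^4}{q^2+1}RL^2-LRL+\frac{q^{-2}}{q^2+1}L^2R=-q^{2e+2D-2}L,$$ $$\frac{q^4}{q^2+1}R^2L-RLR+\frac{q^{-2}}{q^2+1}LR^2=-q^{2e+2D-2}R.$$ -/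

import Mathlib

namespace DualPolar

/-- The six families of forms: `C` is `C_D(b)`, `B` is `B_D(b)`, `D` is `D_D(b)`, `twoD` is
`²D_{D+1}(b)`, `twoAEven` is `²A_{2D}(q)` and `twoAOdd` is `²A_{2D-1}(q)`. -/
inductive FormType
  | C
  | B
  | D
  | twoD
  | twoAEven
  | twoAOdd

/-- The dimension of the underlying vector space. -/
def FormType.dim (t : FormType) (D : ℕ) : ℕ :=
  match t with
  | .C => 2 * D
  | .B => 2 * D + 1
  | .D => 2 * D
  | .twoD => 2 * D + 2
  | .twoAEven => 2 * D + 1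
  | .twoAOdd => 2 * D

/-- The parameter `e` of the form type. -/
def FormType.e : FormType → ℚ
  | .C => 1
  | .B => 1
  | .D => 0
  | .twoD => 2
  | .twoAEven => 3 / 2
  | .twoAOdd => 1 / 2

/-- The integer `2e`, which is what occurs in exponents. -/
def FormType.twoE : FormType → ℕ
  | .C => 2
  | .B => 2
  | .D => 0
  | .twoD => 4
  | .twoAEven => 3
  | .twoAOdd => 1

theorem FormType.twoE_eq (t : FormType) : (t.twoE : ℚ) = 2 * t.e := by
  cases t <;> norm_num [FormType.twoE, FormType.e]

/-- The two families of Hermitian type. -/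
def FormType.IsHermitian (t : FormType) : Prop :=
  t = .twoAEven ∨ t = .twoAOdd

/-- A bilinear form, a quadratic form, or a form that is semilinear in its first argument and
linear in its second one, on the `F`-vector space `U`. -/
inductive Form (F U : Type*) [Field F] [AddCommGroup U] [Module F U]
  | bilinear (β : U →ₗ[F] U →ₗ[F] F)
  | quadratic (Q : QuadraticForm F U)
  | sesquilinear (σ : F →+* F) (H : U →ₛₗ[σ] U →ₗ[F] F)

section

variable {F U : Type*} [Field F] [AddCommGroup U] [Module F U]

/-- `W` is isotropic: the form vanishes completely on `W`. -/
def Form.IsIsotropic (φ : Form F U) (W : Submodule F U) : Prop :=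
  match φ with
  | .bilinear β => ∀ v ∈ W, ∀ w ∈ W, β v w = 0
  | .quadratic Q => ∀ w ∈ W, Q w = 0
  | .sesquilinear _ H => ∀ v ∈ W, ∀ w ∈ W, H v w = 0

/-- The Witt index of `φ`, the largest dimension of an isotropic subspace, equals `D`. -/
def Form.HasWittIndex (φ : Form F U) (D : ℕ) : Prop :=
  IsGreatest {n : ℕ | ∃ W : Submodule F U, φ.IsIsotropic W ∧ Module.finrank F W = n} D

/-- `β` is a nondegenerate symplectic form. -/
def Form.IsSymplectic : Form F U → Prop
  | .bilinear β => β.IsAlt ∧ β.Nondegenerate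
  | _ => False

/-- `Q` is a nondegenerate quadratic form (in every characteristic, 2 included). -/
def Form.IsQuadratic : Form F U → Prop
  | .quadratic Q => Q.Nondegenerate
  | _ => False

/-- `H` is a nondegenerate Hermitian form with respect to a field automorphism `σ` of order 2. -/
def Form.IsHermitian : Form F U → Prop
  | .sesquilinear σ H =>
      (∀ a, σ (σ a) = a) ∧ σ ≠ RingHom.id F ∧ (∀ v w, σ (H v w) = H w v) ∧ H.Nondegenerate
  | _ => False

/-- `φ` is a form of type `t` and rank `D` on `U`. -/
def Form.HasType (φ : Form F U) (t : FormType) (D : ℕ) : Prop :=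
  Module.finrank F U = t.dim D ∧
    match t with
    | .C => φ.IsSymplectic
    | .B => φ.IsQuadratic
    | .D => φ.IsQuadratic ∧ φ.HasWittIndex D
    | .twoD => φ.IsQuadratic ∧ φ.HasWittIndex D
    | .twoAEven => φ.IsHermitian
    | .twoAOdd => φ.IsHermitian

/-- The vertices of the dual polar graph: the maximal isotropic subspaces of `U`. -/
def Form.Vertex (φ : Form F U) : Type _ :=
  {W : Submodule F U // Maximal φ.IsIsotropic W}

noncomputable instance (φ : Form F U) : DecidableEq φ.Vertex := Classical.decEq _

noncomputable instance [Finite F] [FiniteDimensional F U] (φ : Form F U) : Fintype φ.Vertex :=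
  haveI : Finite U := Module.finite_of_finite F
  haveI : Finite φ.Vertex := Subtype.finite
  Fintype.ofFinite _

/-- The dual polar graph: `y`, `z` are adjacent when `dim (y ∩ z) = D - 1`. (The maximal isotropic
subspaces have dimension `D`, so that `y ≠ z` is then automatic.) -/
def Form.dualPolarGraph (φ : Form F U) (D : ℕ) : SimpleGraph φ.Vertex where
  Adj y z := y ≠ z ∧ Module.finrank F (y.1 ⊓ z.1 : Submodule F U) + 1 = D
  symm := ⟨fun y z h => ⟨h.1.symm, by rw [inf_comm]; exact h.2⟩⟩
  loopless := ⟨fun _ h => h.1 rfl⟩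

end

section

variable {X : Type*} (Γ : SimpleGraph X) (x : X)

open Classical in
/-- The lowering matrix of `Γ` with respect to `x`. -/
noncomputable def lowering : Matrix X X ℂ :=
  Matrix.of fun y z => if Γ.Adj y z ∧ Γ.dist x z = Γ.dist x y + 1 then 1 else 0

open Classical in
/-- The flattening matrix of `Γ` with respect to `x`. -/
noncomputable def flattening : Matrix X X ℂ :=
  Matrix.of fun y z => if Γ.Adj y z ∧ Γ.dist x z = Γ.dist x y then 1 else 0

open Classical in
/-- The raising matrix of `Γ` with respect to `x`. -/
noncomputable def raising : Matrix X X ℂ :=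
  Matrix.of fun y z => if Γ.Adj y z ∧ Γ.dist x z + 1 = Γ.dist x y then 1 else 0

open Classical in
/-- The projection `E*_i` onto the span of the vertices at distance `i` from `x`. -/
noncomputable def dualIdempotent (i : ℕ) : Matrix X X ℂ :=
  Matrix.diagonal fun y => if Γ.dist x y = i then 1 else 0

/-- The matrix `K = ∑_{i=0}^D q^{-2i} E*_i`. -/
noncomputable def matK (D : ℕ) (q : ℂ) : Matrix X X ℂ :=
  ∑ i ∈ Finset.range (D + 1), q ^ (-2 * (i : ℤ)) • dualIdempotent Γ x i

end

end DualPolar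

set_option linter.unusedSectionVars false

namespace DualPolar

open Module

/-! ### Counting hyperplanes over a finite field. -/

section Hyperplanes

variable {F U : Type*} [Field F] [AddCommGroup U] [Module F U]

/-! The argument is governed by the trace `y ⊓ x` of a vertex `y` on `x`. The distance from `x` to
`y` is `D` minus the dimension of the trace (`dist_add`), so `L` is the 0/1 matrix of the relation
`Cov`, `R` is its transpose, and the `K` relations are immediate. The engine is the gate property
(`exists_gate`): for isotropic `S` and a vertex `w`, `S ⊔ (w ⊓ perp S)` is a vertex. Hence the
vertices below `z` correspond to the subspaces of `x` that contain `z ⊓ x` as a hyperplane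
(`cov_unique`, `exists_cov`).

The relation between `L` and `F` compares two counts of paths of length two. For the cubic relation,
write `b` for the order of the field. Two vertices with different traces have a common upper
neighbour if and only if they have a common lower one, and then there are `b` of the former and one
of the latter. So `L R = b (R L - T) + Δ`, where `T` is the part of `R L` between equal traces and
`Δ` is the diagonal matrix of upward degrees (`lowering_mul_raising`). Substituting this into `L R
L` and `L² R` cancels `R L²` and leaves an identity between `T L`, `L T`, `Δ L` and `L Δ`, settled
by counting again (`traceRL_commutator`). Transposition gives the relations for `R`.

All this needs only the incidence axioms `Form.IsPolar`. These are proved uniformly for reflexive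
forms (`Form.IsReflexive.isPolar`); the type of the form matters only for the Witt index and for `s
= q ^ (2e)`. -/

theorem card_hyperplanes [Finite F] [FiniteDimensional F U] :
    Nat.card {H : Submodule F U // finrank F H + 1 = finrank F U} =
      ∑ i ∈ Finset.range (finrank F U), Nat.card F ^ i := by
  -- Taking annihilators turns hyperplanes into lines of the dual space, that is, into points of its
  -- projective space.
  rw [← Projectivization.card_of_finrank F (Dual F U) (Subspace.dual_finrank_eq (K := F) (V := U)),
    Nat.card_congr (Projectivization.equivSubmodule F (Dual F U))]
  refine Nat.card_congr (Equiv.subtypeEquiv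
    ((Subspace.orderIsoFiniteDimensional (K := F) (V := U)).toEquiv.trans OrderDual.ofDual) ?_)
  intro H
  have h := Subspace.finrank_add_finrank_dualAnnihilator_eq (K := F) (V := U) H
  change _ ↔ finrank F (Submodule.dualAnnihilator H) = 1
  omega

/-- Hyperplanes of `y` through `N` are the hyperplanes of the quotient of `y` by `N`. -/
theorem card_hyperplanes_between [Finite F] [FiniteDimensional F U] {N y : Submodule F U}
    (h : N ≤ y) :
    Nat.card {M : Submodule F U // N ≤ M ∧ M ≤ y ∧ finrank F M + 1 = finrank F y} =
      ∑ i ∈ Finset.range (finrank F y - finrank F N), Nat.card F ^ i := by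
  set N' : Submodule F y := N.comap y.subtype with hN'
  have hmap : ∀ A : Submodule F y, finrank F (A.map y.subtype) = finrank F A := fun A =>
    (Submodule.equivMapOfInjective y.subtype y.injective_subtype A).finrank_eq.symm
  have hfrN : finrank F N' = finrank F N := by
    rw [← hmap N', hN', Submodule.map_comap_subtype, inf_eq_right.mpr h]
  have hfrq : finrank F (y ⧸ N') + finrank F N = finrank F y := by
    rw [← hfrN]; exact Submodule.finrank_quotient_add_finrank N'
  have hcomap : ∀ H : Submodule F (y ⧸ N'),
      finrank F (H.comap N'.mkQ) = finrank F H + finrank F N := by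
    intro H
    have e := LinearMap.finrank_range_add_finrank_ker (N'.mkQ.domRestrict (H.comap N'.mkQ))
    rw [LinearMap.range_domRestrict, Submodule.map_comap_eq_of_surjective N'.mkQ_surjective] at e
    rw [← e, ← hfrN, LinearMap.ker_domRestrict, Submodule.ker_mkQ]
    congr 1
    have hle : N' ≤ H.comap N'.mkQ := by
      conv_lhs => rw [← Submodule.ker_mkQ N']
      exact LinearMap.ker_le_comap N'.mkQ
    exact (Submodule.submoduleOfEquivOfLe hle).finrank_eq
  have hq : finrank F (y ⧸ N') = finrank F y - finrank F N := by omega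
  rw [← hq, ← card_hyperplanes (F := F) (U := y ⧸ N')]
  symm
  refine Nat.card_eq_of_bijective (fun H => ⟨(H.1.comap N'.mkQ).map y.subtype, ?_, ?_, ?_⟩) ⟨?_, ?_⟩
  · have hle : N' ≤ H.1.comap N'.mkQ := by
      conv_lhs => rw [← Submodule.ker_mkQ N']
      exact LinearMap.ker_le_comap N'.mkQ
    refine le_trans ?_ (Submodule.map_mono hle)
    rw [hN', Submodule.map_comap_subtype, inf_eq_right.mpr h]
  · exact Submodule.map_subtype_le _ _
  · rw [hmap, hcomap]
    have := H.2
    omega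
  · intro H H' e
    have e := congrArg Subtype.val e
    exact Subtype.ext (Submodule.comap_injective_of_surjective N'.mkQ_surjective
      (Submodule.map_injective_of_injective y.injective_subtype e))
  · rintro ⟨M, h1, h2, h3⟩
    have hle : N' ≤ M.comap y.subtype := Submodule.comap_mono h1
    have e1 : ((M.comap y.subtype).map N'.mkQ).comap N'.mkQ = M.comap y.subtype := by
      rw [Submodule.comap_map_mkQ, sup_eq_right.mpr hle]
    have e2 : (M.comap y.subtype).map y.subtype = M := by
      rw [Submodule.map_comap_subtype, inf_eq_right.mpr h2]
    refine ⟨⟨(M.comap y.subtype).map N'.mkQ, ?_⟩, ?_⟩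
    · have := hcomap ((M.comap y.subtype).map N'.mkQ)
      rw [e1, ← hmap, e2] at this
      omega
    · apply Subtype.ext
      simp only [e1, e2]

end Hyperplanes

/-! ### Gates, traces on `x` and the covering relation. -/

section Polar

variable {F U : Type*} [Field F] [AddCommGroup U] [Module F U]

/-- The incidence properties of the isotropic subspaces of a nondegenerate form of Witt index `D`
with orthogonality operator `perp`; `s + 1` is the number of maximal isotropic subspaces through
an isotropic subspace of dimension `D - 1`. -/
structure Form.IsPolar (φ : Form F U) (D s : ℕ) (perp : Submodule F U → Submodule F U) :
    Prop where
  mono {W W' : Submodule F U} : W ≤ W' → φ.IsIsotropic W' → φ.IsIsotropic W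
  le_perp_symm {W W' : Submodule F U} : W ≤ perp W' → W' ≤ perp W
  le_perp {W : Submodule F U} : φ.IsIsotropic W → W ≤ perp W
  sup {W W' : Submodule F U} :
    φ.IsIsotropic W → φ.IsIsotropic W' → W ≤ perp W' → φ.IsIsotropic (W ⊔ W')
  finrank_inf_perp (M : Submodule F U) {x : Submodule F U} : φ.IsIsotropic x →
    finrank F x + finrank F (M ⊓ x : Submodule F U) ≤
      finrank F (x ⊓ perp M : Submodule F U) + finrank F M
  finrank_le {W : Submodule F U} : φ.IsIsotropic W → finrank F W ≤ D
  maximal_iff {W : Submodule F U} :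
    Maximal φ.IsIsotropic W ↔ φ.IsIsotropic W ∧ finrank F W = D
  card_line {M y : Submodule F U} : φ.IsIsotropic y → finrank F y = D → M ≤ y →
    finrank F M + 1 = D →
    Nat.card {w : Submodule F U // φ.IsIsotropic w ∧ finrank F w = D ∧ M ≤ w ∧ w ≠ y} = s

namespace Form.IsPolar

variable [FiniteDimensional F U] {φ : Form F U} {D s : ℕ}
  {perp : Submodule F U → Submodule F U} (P : φ.IsPolar D s perp)
include P

theorem iso (y : φ.Vertex) : φ.IsIsotropic y.1 := (P.maximal_iff.1 y.2).1

theorem finrank_eq (y : φ.Vertex) : finrank F y.1 = D := (P.maximal_iff.1 y.2).2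

theorem perp_anti {A B : Submodule F U} (h : A ≤ B) : perp B ≤ perp A :=
  P.le_perp_symm (h.trans (P.le_perp_symm le_rfl))

theorem vertex_le_perp {A : Submodule F U} {y : φ.Vertex} (h : A ≤ y.1) : y.1 ≤ perp A :=
  (P.le_perp (P.iso y)).trans (P.perp_anti h)

theorem eq_of_le {y z : φ.Vertex} (h : y.1 ≤ z.1) : y = z :=
  Subtype.ext (Submodule.eq_of_le_of_finrank_eq h ((P.finrank_eq y).trans (P.finrank_eq z).symm))

theorem le_of_le_perp {W : Submodule F U} (y : φ.Vertex) (hW : φ.IsIsotropic W)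
    (h : W ≤ perp y.1) : W ≤ y.1 := by
  have h1 := P.finrank_le (P.sup hW (P.iso y) h)
  rw [← P.finrank_eq y] at h1
  have h2 := Submodule.eq_of_le_of_finrank_le (le_sup_right : y.1 ≤ W ⊔ y.1) h1
  exact h2 ▸ le_sup_left

/-- The space `S ⊔ (w ⊓ perp S)` is isotropic, so its dimension is at most `D`; `finrank_inf_perp`
shows that it is at least `D`. Both bounds are therefore equalities. -/
theorem exists_gate {S : Submodule F U} (hS : φ.IsIsotropic S) (w : φ.Vertex) :
    (∃ g : φ.Vertex, g.1 = S ⊔ (w.1 ⊓ perp S)) ∧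
      finrank F (w.1 ⊓ perp S : Submodule F U) + finrank F S =
        D + finrank F (S ⊓ w.1 : Submodule F U) := by
  have hiso : φ.IsIsotropic (S ⊔ (w.1 ⊓ perp S)) :=
    P.sup hS (P.mono inf_le_left (P.iso w)) (P.le_perp_symm inf_le_right)
  have h1 := P.finrank_inf_perp S (P.iso w)
  have h2 := Submodule.finrank_sup_add_finrank_inf_eq S (w.1 ⊓ perp S)
  have h3 : S ⊓ (w.1 ⊓ perp S) = S ⊓ w.1 :=
    le_antisymm (inf_le_inf_left _ inf_le_left)
      (le_inf inf_le_left (le_inf inf_le_right (inf_le_left.trans (P.le_perp hS))))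
  rw [h3] at h2
  have h4 := P.finrank_le hiso
  have h5 := P.finrank_eq w
  exact ⟨⟨⟨_, P.maximal_iff.2 ⟨hiso, by omega⟩⟩, rfl⟩, by omega⟩

theorem adj_of_le {M : Submodule F U} {y z : φ.Vertex} (hy : M ≤ y.1) (hz : M ≤ z.1)
    (hM : finrank F M + 1 = D) (hne : y ≠ z) :
    (φ.dualPolarGraph D).Adj y z ∧ y.1 ⊓ z.1 = M := by
  have hle : M ≤ y.1 ⊓ z.1 := le_inf hy hz
  have h1 := Submodule.finrank_mono hle
  have h2 : finrank F (y.1 ⊓ z.1 : Submodule F U) < finrank F y.1 := by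
    refine Submodule.finrank_lt_finrank_of_lt (lt_of_le_of_ne inf_le_left fun h => hne ?_)
    exact P.eq_of_le (inf_eq_left.1 h)
  rw [P.finrank_eq y] at h2
  have h3 := Submodule.eq_of_le_of_finrank_eq hle (by omega)
  exact ⟨⟨hne, by rw [← h3]; exact hM⟩, h3.symm⟩

/-- Mutually adjacent vertices lie on one line: if `w ⊓ y` and `w ⊓ z` differ, they span `w`, and
both are orthogonal to `y ⊓ z`, which maximality of `w` then absorbs. -/
theorem inf_le_of_adj {y z w : φ.Vertex} (hyz : (φ.dualPolarGraph D).Adj y z)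
    (hwy : (φ.dualPolarGraph D).Adj w y) (hwz : (φ.dualPolarGraph D).Adj w z) :
    y.1 ⊓ z.1 ≤ w.1 := by
  by_cases h : w.1 ⊓ y.1 = w.1 ⊓ z.1
  · have hle : w.1 ⊓ y.1 ≤ y.1 ⊓ z.1 := le_inf inf_le_right (h ▸ inf_le_right)
    have := Submodule.eq_of_le_of_finrank_eq hle (by have := hyz.2; have := hwy.2; omega)
    exact this ▸ inf_le_left
  · have hw : (w.1 ⊓ y.1) ⊔ (w.1 ⊓ z.1) = w.1 := by
      refine Submodule.eq_of_le_of_finrank_le (sup_le inf_le_left inf_le_left) ?_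
      rw [P.finrank_eq w, ← hwy.2]
      refine Submodule.finrank_lt_finrank_of_lt (lt_of_le_of_ne le_sup_left fun h' => h ?_)
      exact (Submodule.eq_of_le_of_finrank_eq (sup_eq_left.1 h'.symm)
        (by have := hwy.2; have := hwz.2; omega)).symm
    refine P.le_of_le_perp w (P.mono inf_le_left (P.iso y)) (P.le_perp_symm ?_)
    rw [← hw]
    exact sup_le (inf_le_right.trans (P.vertex_le_perp inf_le_left))
      (inf_le_right.trans (P.vertex_le_perp inf_le_right))

/-- With `M = y ⊓ z`, the gate formula gives `x ⊓ perp M` one dimension more than `M ⊓ x`. Since `y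
⊓ x` lies in it and is strictly larger than `M ⊓ x`, the two agree; and `z ⊓ x` lies in it as well.
-/
theorem gate_of_adj {x y z : φ.Vertex} (hyz : (φ.dualPolarGraph D).Adj y z)
    (h : ¬ y.1 ⊓ x.1 ≤ z.1) :
    finrank F (y.1 ⊓ x.1 : Submodule F U) = finrank F (z.1 ⊓ x.1 : Submodule F U) + 1 ∧
      z.1 ⊓ x.1 = y.1 ⊓ z.1 ⊓ x.1 := by
  have hM := (P.exists_gate (P.mono (inf_le_left : y.1 ⊓ z.1 ≤ y.1) (P.iso y)) x).2
  have hadj := hyz.2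
  have hle : y.1 ⊓ x.1 ≤ x.1 ⊓ perp (y.1 ⊓ z.1) :=
    le_inf inf_le_right (inf_le_left.trans (P.vertex_le_perp inf_le_left))
  have hlt : y.1 ⊓ z.1 ⊓ x.1 < y.1 ⊓ x.1 :=
    lt_of_le_of_ne (inf_le_inf_right _ inf_le_left)
      fun e => h (e ▸ (inf_le_left.trans inf_le_right))
  have hlt' := Submodule.finrank_lt_finrank_of_lt hlt
  have heq := Submodule.eq_of_le_of_finrank_le hle (by omega)
  have hz : z.1 ⊓ x.1 = y.1 ⊓ z.1 ⊓ x.1 := by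
    refine le_antisymm (le_inf (le_inf ?_ inf_le_left) inf_le_right)
      (inf_le_inf_right _ inf_le_right)
    refine le_trans ?_ (inf_le_left : y.1 ⊓ x.1 ≤ y.1)
    rw [heq]
    exact le_inf inf_le_right (inf_le_left.trans (P.vertex_le_perp inf_le_right))
  refine ⟨?_, hz⟩
  rw [hz, heq]
  omega

end Form.IsPolar

/-- `y` lies below `z`: the two are adjacent and `y` is the nearer one to `x`. -/
def Form.Cov (φ : Form F U) (D : ℕ) (x y z : φ.Vertex) : Prop :=
  (φ.dualPolarGraph D).Adj y z ∧
    finrank F (y.1 ⊓ x.1 : Submodule F U) = finrank F (z.1 ⊓ x.1 : Submodule F U) + 1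

namespace Form.IsPolar

variable [FiniteDimensional F U] {φ : Form F U} {D s : ℕ}
  {perp : Submodule F U → Submodule F U} (P : φ.IsPolar D s perp) {x y z u u' v w : φ.Vertex}
include P

theorem cov_iff : φ.Cov D x y z ↔ (φ.dualPolarGraph D).Adj y z ∧ ¬ y.1 ⊓ x.1 ≤ z.1 := by
  refine ⟨fun h => ⟨h.1, fun hle => ?_⟩, fun h => ⟨h.1, (P.gate_of_adj h.1 h.2).1⟩⟩
  have := Submodule.finrank_mono (le_inf hle inf_le_right : y.1 ⊓ x.1 ≤ z.1 ⊓ x.1)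
  have := h.2
  omega

theorem cov_inf_eq (h : φ.Cov D x y z) : z.1 ⊓ x.1 = y.1 ⊓ z.1 ⊓ x.1 :=
  (P.gate_of_adj h.1 (P.cov_iff.1 h).2).2

theorem cov_inf_le (h : φ.Cov D x y z) : z.1 ⊓ x.1 ≤ y.1 ⊓ x.1 := by
  rw [P.cov_inf_eq h]
  exact inf_le_inf_right _ inf_le_left

theorem inf_eq_or_cov (h : (φ.dualPolarGraph D).Adj y z) :
    y.1 ⊓ x.1 = z.1 ⊓ x.1 ∨ φ.Cov D x y z ∨ φ.Cov D x z y := by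
  by_cases h1 : y.1 ⊓ x.1 ≤ z.1
  · by_cases h2 : z.1 ⊓ x.1 ≤ y.1
    · exact Or.inl (le_antisymm (le_inf h1 inf_le_right) (le_inf h2 inf_le_right))
    · exact Or.inr (Or.inr (P.cov_iff.2 ⟨h.symm, h2⟩))
  · exact Or.inr (Or.inl (P.cov_iff.2 ⟨h, h1⟩))

theorem inf_eq_of_adj (h : (φ.dualPolarGraph D).Adj y z)
    (hf : finrank F (y.1 ⊓ x.1 : Submodule F U) = finrank F (z.1 ⊓ x.1 : Submodule F U)) :
    y.1 ⊓ x.1 = z.1 ⊓ x.1 := by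
  rcases P.inf_eq_or_cov (x := x) h with h | h | h
  · exact h
  · have := h.2; omega
  · have := h.2; omega

/-- Both `u ⊓ z` and `z ⊓ perp (u ⊓ x)` have dimension `D - 1`, so they coincide. Thus `u` is the
gate of its own trace and `z`, which is what makes `cov_unique` work. -/
theorem cov_perp_le (h : φ.Cov D x u z) : z.1 ⊓ perp (u.1 ⊓ x.1) ≤ u.1 := by
  have h1 := (P.exists_gate (P.mono (inf_le_left : u.1 ⊓ x.1 ≤ u.1) (P.iso u)) z).2
  have h2 : u.1 ⊓ x.1 ⊓ z.1 = z.1 ⊓ x.1 := by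
    rw [P.cov_inf_eq h, inf_right_comm]
  have h3 : u.1 ⊓ z.1 ≤ z.1 ⊓ perp (u.1 ⊓ x.1) :=
    le_inf inf_le_right (inf_le_left.trans (P.vertex_le_perp inf_le_left))
  rw [h2] at h1
  have h4 := h.1.2
  have h5 := h.2
  rw [← Submodule.eq_of_le_of_finrank_le h3 (by omega)]
  exact inf_le_left

/-- A vertex containing the gate of `S` and `w` is determined by `S` and `w`. -/
theorem eq_of_gate_le {S : Submodule F U} (hu : S ≤ u.1) (hv : S ≤ v.1)
    (hu' : w.1 ⊓ perp S ≤ u.1) (hv' : w.1 ⊓ perp S ≤ v.1) : u = v := by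
  obtain ⟨g, hg⟩ := (P.exists_gate (P.mono hu (P.iso u)) w).1
  rw [← P.eq_of_le (y := g) (z := u) (hg ▸ sup_le hu hu'),
    ← P.eq_of_le (y := g) (z := v) (hg ▸ sup_le hv hv')]

theorem cov_unique (h : φ.Cov D x u z) (h' : φ.Cov D x u' z) (e : u.1 ⊓ x.1 = u'.1 ⊓ x.1) :
    u = u' :=
  P.eq_of_gate_le (w := z) (S := u.1 ⊓ x.1) inf_le_left (e ▸ inf_le_left) (P.cov_perp_le h)
    (e ▸ P.cov_perp_le h')

theorem exists_cov {T : Submodule F U} (hT : T ≤ x.1) (hz : z.1 ⊓ x.1 ≤ T)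
    (hf : finrank F T = finrank F (z.1 ⊓ x.1 : Submodule F U) + 1) :
    ∃ u : φ.Vertex, φ.Cov D x u z ∧ u.1 ⊓ x.1 = T := by
  obtain ⟨⟨u, hu⟩, h1⟩ := P.exists_gate (P.mono hT (P.iso x)) z
  have hTz : T ⊓ z.1 = z.1 ⊓ x.1 :=
    le_antisymm (le_inf inf_le_right (inf_le_left.trans hT)) (le_inf hz inf_le_left)
  rw [hTz] at h1
  have hTu : T ≤ u.1 ⊓ x.1 := le_inf (hu ▸ le_sup_left) hT
  have hn : ¬ T ≤ z.1 := fun h => by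
    rw [inf_eq_left.2 h] at hTz
    rw [← hTz] at hf
    omega
  have hne : u ≠ z := fun e => hn (e ▸ hTu.trans inf_le_left)
  have hadj := (P.adj_of_le (M := z.1 ⊓ perp T) (hu ▸ le_sup_right) inf_le_left (by omega) hne).1
  have hcov : φ.Cov D x u z := P.cov_iff.2 ⟨hadj, fun h => hn (hTu.trans h)⟩
  exact ⟨u, hcov, (Submodule.eq_of_le_of_finrank_eq hTu (hf.trans hcov.2.symm)).symm⟩

theorem cov_perp_le_of_cov_cov (h : φ.Cov D x v u) (h' : φ.Cov D x u z) :
    z.1 ⊓ perp (v.1 ⊓ x.1) ≤ v.1 := by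
  refine le_trans (le_inf ?_ inf_le_right) (P.cov_perp_le h)
  exact (inf_le_inf_left _ (P.perp_anti (P.cov_inf_le h))).trans (P.cov_perp_le h')

/-- The vertex below `u'` with the trace of `v` and `v` itself are both the gate of that trace and
`z`. -/
theorem cov_of_cov_cov (h : φ.Cov D x v u) (h' : φ.Cov D x u z) (hu : φ.Cov D x u' z)
    (hle : u'.1 ⊓ x.1 ≤ v.1) : φ.Cov D x v u' := by
  have hle' : u'.1 ⊓ x.1 ≤ v.1 ⊓ x.1 := le_inf hle inf_le_right
  obtain ⟨g, hg, hgx⟩ := P.exists_cov (z := u') (T := v.1 ⊓ x.1) inf_le_right hle'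
    (by have := h.2; have := h'.2; have := hu.2; omega)
  have : g = v := by
    refine P.eq_of_gate_le (w := z) (S := v.1 ⊓ x.1) (hgx ▸ inf_le_left) inf_le_left ?_
      (P.cov_perp_le_of_cov_cov h h')
    rw [← hgx]
    exact P.cov_perp_le_of_cov_cov hg hu
  exact this ▸ hg

theorem inf_eq_inf_inf (hu : φ.Cov D x u w) (hy : φ.Cov D x y w)
    (hne : u.1 ⊓ x.1 ≠ y.1 ⊓ x.1) : w.1 ⊓ x.1 = u.1 ⊓ x.1 ⊓ (y.1 ⊓ x.1) := by
  refine Submodule.eq_of_le_of_finrank_le (le_inf (P.cov_inf_le hu) (P.cov_inf_le hy)) ?_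
  have hlt : u.1 ⊓ x.1 ⊓ (y.1 ⊓ x.1) < u.1 ⊓ x.1 :=
    lt_of_le_of_ne inf_le_left fun e => hne (Submodule.eq_of_le_of_finrank_eq
      (inf_eq_left.1 e) (by have := hu.2; have := hy.2; omega))
  have := Submodule.finrank_lt_finrank_of_lt hlt
  have := hu.2
  omega

theorem inf_eq_sup (hu : φ.Cov D x v u) (hy : φ.Cov D x v y)
    (hne : u.1 ⊓ x.1 ≠ y.1 ⊓ x.1) : v.1 ⊓ x.1 = u.1 ⊓ x.1 ⊔ y.1 ⊓ x.1 := by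
  refine (Submodule.eq_of_le_of_finrank_le (sup_le (P.cov_inf_le hu) (P.cov_inf_le hy)) ?_).symm
  have hlt : u.1 ⊓ x.1 < u.1 ⊓ x.1 ⊔ y.1 ⊓ x.1 :=
    lt_of_le_of_ne le_sup_left fun e => hne (Submodule.eq_of_le_of_finrank_eq
      (sup_eq_left.1 e.symm) (by have := hu.2; have := hy.2; omega)).symm
  have := Submodule.finrank_lt_finrank_of_lt hlt
  have := hu.2
  omega

/-- The sum of the two traces is the trace of a vertex below `u` and of one below `y`; both are its
gate with `w`, hence equal. -/
theorem exists_meet (hu : φ.Cov D x u w) (hy : φ.Cov D x y w)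
    (hne : u.1 ⊓ x.1 ≠ y.1 ⊓ x.1) : ∃ v, φ.Cov D x v u ∧ φ.Cov D x v y := by
  have h1 := Submodule.finrank_sup_add_finrank_inf_eq (u.1 ⊓ x.1) (y.1 ⊓ x.1)
  rw [← P.inf_eq_inf_inf hu hy hne] at h1
  have h2 := hu.2
  have h3 := hy.2
  obtain ⟨v, hv, hvx⟩ := P.exists_cov (z := u) (T := u.1 ⊓ x.1 ⊔ y.1 ⊓ x.1)
    (sup_le inf_le_right inf_le_right) le_sup_left (by omega)
  obtain ⟨v', hv', hvx'⟩ := P.exists_cov (z := y) (T := u.1 ⊓ x.1 ⊔ y.1 ⊓ x.1)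
    (sup_le inf_le_right inf_le_right) le_sup_right (by omega)
  have : v = v' := by
    refine P.eq_of_gate_le (w := w) (hvx ▸ inf_le_left) (hvx' ▸ inf_le_left) ?_ ?_
    · rw [← hvx]; exact P.cov_perp_le_of_cov_cov hv hu
    · rw [← hvx']; exact P.cov_perp_le_of_cov_cov hv' hy
  exact ⟨v, hv, this ▸ hv'⟩

theorem meet_unique {v' : φ.Vertex} (hu : φ.Cov D x v u) (hy : φ.Cov D x v y)
    (hu' : φ.Cov D x v' u) (hy' : φ.Cov D x v' y) (hne : u.1 ⊓ x.1 ≠ y.1 ⊓ x.1) : v = v' :=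
  P.cov_unique hu hu' ((P.inf_eq_sup hu hy hne).trans (P.inf_eq_sup hu' hy' hne).symm)

/-- The trace can be enlarged by one dimension at a time along edges (`exists_cov`), and no edge
changes its dimension by more than one. -/
theorem dist_add (x y : φ.Vertex) : (φ.dualPolarGraph D).Reachable x y ∧
    (φ.dualPolarGraph D).dist x y + finrank F (y.1 ⊓ x.1 : Submodule F U) = D := by
  have hup : ∀ n, ∀ y : φ.Vertex, finrank F (y.1 ⊓ x.1 : Submodule F U) + n = D →
      ∃ p : (φ.dualPolarGraph D).Walk x y, p.length = n := by
    intro n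
    induction n with
    | zero =>
      intro y hy
      have : x = y := by
        refine P.eq_of_le (inf_eq_right.1 (Submodule.eq_of_le_of_finrank_eq inf_le_right ?_))
        rw [P.finrank_eq x]; omega
      subst this
      exact ⟨.nil, rfl⟩
    | succ n ih =>
      intro y hy
      have hlt : y.1 ⊓ x.1 < x.1 := by
        refine lt_of_le_of_ne inf_le_right fun e => ?_
        rw [e, P.finrank_eq x] at hy
        omega
      obtain ⟨a, hax, hay⟩ := SetLike.exists_of_lt hlt
      have hle : y.1 ⊓ x.1 ⊔ F ∙ a ≤ x.1 :=
        sup_le inf_le_right ((Submodule.span_singleton_le_iff_mem _ _).2 hax)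
      obtain ⟨u, hu, -⟩ := P.exists_cov (z := y) (T := y.1 ⊓ x.1 ⊔ F ∙ a) hle le_sup_left
        (by
          have h1 := Submodule.finrank_sup_add_finrank_inf_eq (y.1 ⊓ x.1) (F ∙ a)
          have h2 : y.1 ⊓ x.1 ⊓ F ∙ a = ⊥ := by
            rw [← disjoint_iff]
            exact Submodule.disjoint_span_singleton_of_notMem hay
          have h3 : finrank F (F ∙ a) = 1 :=
            finrank_span_singleton (fun h => hay (h ▸ Submodule.zero_mem _))
          rw [h2, finrank_bot, h3] at h1
          exact h1)
      obtain ⟨p, hp⟩ := ih u (by have := hu.2; omega)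
      exact ⟨p.concat hu.1, by rw [SimpleGraph.Walk.length_concat, hp]⟩
  have hlow : ∀ (y z : φ.Vertex) (p : (φ.dualPolarGraph D).Walk y z),
      finrank F (y.1 ⊓ x.1 : Submodule F U) ≤ finrank F (z.1 ⊓ x.1 : Submodule F U) + p.length := by
    intro y z p
    induction p with
    | nil => simp
    | cons h p ih =>
      rw [SimpleGraph.Walk.length_cons]
      rcases P.inf_eq_or_cov (x := x) h with h | h | h
      · rw [h]; omega
      · have := h.2; omega
      · have := h.2; omega
  have hle : finrank F (y.1 ⊓ x.1 : Submodule F U) ≤ D :=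
    P.finrank_le (P.mono inf_le_left (P.iso y))
  obtain ⟨p, hp⟩ := hup (D - finrank F (y.1 ⊓ x.1 : Submodule F U)) y (by omega)
  refine ⟨p.reachable, ?_⟩
  obtain ⟨p', hp'⟩ := p.reachable.exists_walk_length_eq_dist
  have h1 := hlow x y p'
  have h2 := SimpleGraph.dist_le p
  rw [inf_idem, P.finrank_eq x] at h1
  omega

end Form.IsPolar

end Polar

theorem natCard_split {α : Type*} [Finite α] (p q : α → Prop) :
    Nat.card {a // p a} = Nat.card {a // p a ∧ q a} + Nat.card {a // p a ∧ ¬ q a} := by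
  have := Set.ncard_inter_add_ncard_sdiff_eq_ncard {a | p a} {a | q a} (Set.toFinite _)
  exact this.symm

theorem natCard_and_eq {α : Type*} {p : α → Prop} {a : α} (h : p a) :
    Nat.card {b // p b ∧ b = a} = 1 :=
  (Nat.card_congr (Equiv.subtypeEquivRight fun _ => ⟨fun h' => h'.2, fun e => ⟨e ▸ h, e⟩⟩)).trans
    (Nat.card_unique (α := {b // b = a}))

/-! ### Counting neighbours and paths of length two. -/

section Polar

variable {F U : Type*} [Field F] [AddCommGroup U] [Module F U]

/-- `y` and `z` are adjacent and at the same distance from `x`. -/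
def Form.Flat (φ : Form F U) (D : ℕ) (x y z : φ.Vertex) : Prop :=
  (φ.dualPolarGraph D).Adj y z ∧
    finrank F (y.1 ⊓ x.1 : Submodule F U) = finrank F (z.1 ⊓ x.1 : Submodule F U)

namespace Form.IsPolar

variable [FiniteDimensional F U] {φ : Form F U} {D s : ℕ}
  {perp : Submodule F U → Submodule F U} (P : φ.IsPolar D s perp) {x y z u u' v w : φ.Vertex}
include P

theorem natCard_line {M : Submodule F U} (hM : M ≤ y.1) (hf : finrank F M + 1 = D) :
    Nat.card {w : φ.Vertex // M ≤ w.1 ∧ w ≠ y} = s := by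
  rw [← P.card_line (P.iso y) (P.finrank_eq y) hM hf]
  refine Nat.card_eq_of_bijective (fun w => ⟨w.1.1, P.iso w.1, P.finrank_eq w.1, w.2.1,
    fun e => w.2.2 (Subtype.ext e)⟩) ⟨fun a b e => ?_, fun a => ?_⟩
  · simp only [Subtype.mk.injEq] at e
    exact Subtype.ext (Subtype.ext e)
  · exact ⟨⟨⟨a.1, P.maximal_iff.2 ⟨a.2.1, a.2.2.1⟩⟩, a.2.2.2.1,
      fun e => a.2.2.2.2 (congrArg Subtype.val e)⟩, rfl⟩

theorem inf_vertex_le_of_adj (hyz : finrank F (y.1 ⊓ z.1 : Submodule F U) + 2 = D)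
    (hy : (φ.dualPolarGraph D).Adj w y) (hz : (φ.dualPolarGraph D).Adj w z) :
    y.1 ⊓ z.1 ≤ w.1 := by
  have h1 := Submodule.finrank_sup_add_finrank_inf_eq (w.1 ⊓ y.1) (w.1 ⊓ z.1)
  have h2 := Submodule.finrank_mono
    (sup_le inf_le_left inf_le_left : w.1 ⊓ y.1 ⊔ w.1 ⊓ z.1 ≤ w.1)
  have hle : w.1 ⊓ y.1 ⊓ (w.1 ⊓ z.1) ≤ y.1 ⊓ z.1 := inf_le_inf inf_le_right inf_le_right
  have h3 := hy.2
  have h4 := hz.2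
  rw [P.finrank_eq w] at h2
  rw [← Submodule.eq_of_le_of_finrank_le hle (by omega)]
  exact inf_le_left.trans inf_le_left

/-- A common neighbour `w` is the gate of `w ⊓ y` and `z`, and `w ⊓ y` can be any of the `|F| + 1`
hyperplanes of `y` through `y ⊓ z`. -/
theorem natCard_adj_adj [Finite F] (hyz : finrank F (y.1 ⊓ z.1 : Submodule F U) + 2 = D) :
    Nat.card {w : φ.Vertex // (φ.dualPolarGraph D).Adj w y ∧ (φ.dualPolarGraph D).Adj w z} =
      Nat.card F + 1 := by
  have h := card_hyperplanes_between (inf_le_left : y.1 ⊓ z.1 ≤ y.1)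
  have h2 : finrank F y.1 - finrank F (y.1 ⊓ z.1 : Submodule F U) = 2 := by
    rw [P.finrank_eq y]; omega
  rw [h2, Finset.sum_range_succ, Finset.sum_range_one, pow_zero, pow_one, add_comm] at h
  rw [← h]
  have hinf : ∀ M : Submodule F U, y.1 ⊓ z.1 ≤ M → M ≤ y.1 → finrank F M + 1 = finrank F y.1 →
      finrank F (z.1 ⊓ perp M : Submodule F U) + 1 = D := by
    intro M h1 h2 h3
    have h4 := (P.exists_gate (P.mono h2 (P.iso y)) z).2
    have h5 : M ⊓ z.1 = y.1 ⊓ z.1 :=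
      le_antisymm (inf_le_inf_right _ h2) (le_inf h1 inf_le_right)
    rw [h5] at h4
    have := P.finrank_eq y
    omega
  refine Nat.card_eq_of_bijective (fun w => ⟨w.1.1 ⊓ y.1,
    le_inf (P.inf_vertex_le_of_adj hyz w.2.1 w.2.2) inf_le_left, inf_le_right,
    w.2.1.2.trans (P.finrank_eq y).symm⟩) ⟨?_, ?_⟩
  · have key : ∀ a : φ.Vertex, (φ.dualPolarGraph D).Adj a y → (φ.dualPolarGraph D).Adj a z →
        z.1 ⊓ perp (a.1 ⊓ y.1) ≤ a.1 := by
      intro a ha hb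
      have hle : a.1 ⊓ z.1 ≤ z.1 ⊓ perp (a.1 ⊓ y.1) :=
        le_inf inf_le_right (inf_le_left.trans (P.vertex_le_perp inf_le_left))
      have h1 := hinf (a.1 ⊓ y.1) (le_inf (P.inf_vertex_le_of_adj hyz ha hb) inf_le_left)
        inf_le_right (ha.2.trans (P.finrank_eq y).symm)
      rw [← Submodule.eq_of_le_of_finrank_eq hle (by have := hb.2; omega)]
      exact inf_le_left
    rintro ⟨a, ha⟩ ⟨b, hb⟩ e
    have e : a.1 ⊓ y.1 = b.1 ⊓ y.1 := congrArg Subtype.val e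
    exact Subtype.ext (P.eq_of_gate_le (w := z) (S := a.1 ⊓ y.1) inf_le_left (e ▸ inf_le_left)
      (key a ha.1 ha.2) (e ▸ key b hb.1 hb.2))
  · rintro ⟨M, h1, h2, h3⟩
    have h4 := hinf M h1 h2 h3
    obtain ⟨⟨g, hg⟩, -⟩ := P.exists_gate (P.mono h2 (P.iso y)) z
    have hgz : z.1 ⊓ perp M ≤ g.1 := hg ▸ le_sup_right
    have hgM : M ≤ g.1 := hg ▸ le_sup_left
    have hny : g ≠ y := by
      intro e
      have := Submodule.finrank_mono (le_inf (e ▸ hgz) inf_le_left : z.1 ⊓ perp M ≤ y.1 ⊓ z.1)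
      omega
    have hnz : g ≠ z := by
      intro e
      have := Submodule.finrank_mono (le_inf h2 (e ▸ hgM) : M ≤ y.1 ⊓ z.1)
      have := P.finrank_eq y
      omega
    have hay := P.adj_of_le hgM h2 (h3.trans (P.finrank_eq y)) hny
    have haz := P.adj_of_le hgz inf_le_left h4 hnz
    exact ⟨⟨g, hay.1, haz.1⟩, Subtype.ext hay.2⟩

/-- Sort the neighbours by the hyperplane `y ⊓ w` of `y`; each hyperplane carries `s` of them. -/
theorem natCard_adj_le [Finite F] {S : Submodule F U} (hS : S ≤ y.1) :
    Nat.card {w : φ.Vertex // (φ.dualPolarGraph D).Adj y w ∧ S ≤ w.1} =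
      (∑ i ∈ Finset.range (D - finrank F S), Nat.card F ^ i) * s := by
  have h := card_hyperplanes_between hS
  rw [P.finrank_eq y] at h
  rw [← h]
  have : Finite U := Module.finite_of_finite F
  have e : {w : φ.Vertex // (φ.dualPolarGraph D).Adj y w ∧ S ≤ w.1} ≃
      Σ M : {M : Submodule F U // S ≤ M ∧ M ≤ y.1 ∧ finrank F M + 1 = D},
        {w : φ.Vertex // M.1 ≤ w.1 ∧ w ≠ y} :=
    { toFun := fun w => ⟨⟨y.1 ⊓ w.1.1, le_inf hS w.2.2, inf_le_left, w.2.1.2⟩,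
        ⟨w.1, inf_le_right, w.2.1.1.symm⟩⟩
      invFun := fun p => ⟨p.2.1, (P.adj_of_le p.1.2.2.1 p.2.2.1 p.1.2.2.2 p.2.2.2.symm).1,
        p.1.2.1.trans p.2.2.1⟩
      left_inv := fun w => rfl
      right_inv := by
        rintro ⟨⟨M, h1, h2, h3⟩, ⟨w, h4, h5⟩⟩
        have := (P.adj_of_le h2 h4 h3 h5.symm).2
        subst this
        rfl }
  have hfin : Finite φ.Vertex := Subtype.finite
  have hft : Fintype {M : Submodule F U // S ≤ M ∧ M ≤ y.1 ∧ finrank F M + 1 = D} :=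
    Fintype.ofFinite _
  rw [Nat.card_congr e, Nat.card_sigma]
  rw [Finset.sum_congr rfl fun M _ => P.natCard_line M.2.2.1 M.2.2.2]
  simp

theorem natCard_adj_le_not_le [Finite F] {S T : Submodule F U} (hST : S ≤ T) (hT : T ≤ y.1) :
    Nat.card {w : φ.Vertex // (φ.dualPolarGraph D).Adj y w ∧ S ≤ w.1 ∧ ¬ T ≤ w.1} +
      (∑ i ∈ Finset.range (D - finrank F T), Nat.card F ^ i) * s =
      (∑ i ∈ Finset.range (D - finrank F S), Nat.card F ^ i) * s := by
  have : Finite U := Module.finite_of_finite F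
  have hfin : Finite φ.Vertex := Subtype.finite
  rw [← P.natCard_adj_le hT, ← P.natCard_adj_le (hST.trans hT),
    natCard_split (fun w : φ.Vertex => (φ.dualPolarGraph D).Adj y w ∧ S ≤ w.1) (fun w => T ≤ w.1),
    add_comm]
  congr 1
  · refine Nat.card_congr (Equiv.subtypeEquivRight fun w => ?_)
    exact ⟨fun h => ⟨⟨h.1, hST.trans h.2⟩, h.2⟩, fun h => ⟨h.1.1, h.2⟩⟩
  · exact Nat.card_congr (Equiv.subtypeEquivRight fun w => and_assoc.symm)

/-- By `cov_iff`, these are the neighbours of `y` that do not contain its trace. Subtraction is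
avoided by an additive form. -/
theorem natCard_cov [Finite F] :
    Nat.card {w : φ.Vertex // φ.Cov D x y w} +
      (∑ i ∈ Finset.range (D - finrank F (y.1 ⊓ x.1 : Submodule F U)), Nat.card F ^ i) * s =
      (∑ i ∈ Finset.range D, Nat.card F ^ i) * s := by
  have h := P.natCard_adj_le_not_le (y := y) (bot_le : ⊥ ≤ y.1 ⊓ x.1) inf_le_left
  rw [finrank_bot, Nat.sub_zero] at h
  rw [← h]
  congr 1
  refine Nat.card_congr (Equiv.subtypeEquivRight fun w => ?_)
  rw [P.cov_iff]
  simp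

theorem natCard_cov_inf_eq [Finite F] {S : Submodule F U} (hS : S ≤ y.1 ⊓ x.1)
    (hf : finrank F (y.1 ⊓ x.1 : Submodule F U) = finrank F S + 1) :
    Nat.card {w : φ.Vertex // φ.Cov D x y w ∧ w.1 ⊓ x.1 = S} +
      (∑ i ∈ Finset.range (D - finrank F (y.1 ⊓ x.1 : Submodule F U)), Nat.card F ^ i) * s =
      (∑ i ∈ Finset.range (D - finrank F S), Nat.card F ^ i) * s := by
  rw [← P.natCard_adj_le_not_le hS inf_le_left]
  congr 1
  refine Nat.card_congr (Equiv.subtypeEquivRight fun w => ?_)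
  rw [P.cov_iff]
  refine ⟨fun h => ⟨h.1.1, h.2 ▸ inf_le_left, h.1.2⟩, fun h => ⟨⟨h.1, h.2.2⟩, ?_⟩⟩
  have hc := (P.cov_iff (x := x)).2 ⟨h.1, h.2.2⟩
  exact (Submodule.eq_of_le_of_finrank_eq (le_inf h.2.1 (hS.trans inf_le_right))
    (by have := hc.2; omega)).symm

theorem inf_eq_of_flat (h : φ.Flat D x y z) : y.1 ⊓ x.1 = z.1 ⊓ x.1 := P.inf_eq_of_adj h.1 h.2

theorem finrank_inf_of_cov (hu : φ.Cov D x v u) (hy : φ.Cov D x v y)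
    (hne : u ≠ y) (hn : ¬ (φ.dualPolarGraph D).Adj u y) :
    finrank F (u.1 ⊓ y.1 : Submodule F U) + 2 = D := by
  have h1 := Submodule.finrank_sup_add_finrank_inf_eq (v.1 ⊓ u.1) (v.1 ⊓ y.1)
  have h2 := Submodule.finrank_mono
    (sup_le inf_le_left inf_le_left : v.1 ⊓ u.1 ⊔ v.1 ⊓ y.1 ≤ v.1)
  have h3 := Submodule.finrank_mono
    (inf_le_inf inf_le_right inf_le_right : v.1 ⊓ u.1 ⊓ (v.1 ⊓ y.1) ≤ u.1 ⊓ y.1)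
  have h4 := hu.1.2
  have h5 := hy.1.2
  have h6 : finrank F (u.1 ⊓ y.1 : Submodule F U) < finrank F u.1 :=
    Submodule.finrank_lt_finrank_of_lt (lt_of_le_of_ne inf_le_left
      fun e => hne (P.eq_of_le (inf_eq_left.1 e)))
  have h7 : ¬ finrank F (u.1 ⊓ y.1 : Submodule F U) + 1 = D := fun e => hn ⟨hne, e⟩
  rw [P.finrank_eq] at h2 h6
  omega

theorem not_adj_of_cov (hu : φ.Cov D x v u) (hy : φ.Cov D x v y)
    (hne : u.1 ⊓ x.1 ≠ y.1 ⊓ x.1) : ¬ (φ.dualPolarGraph D).Adj u y := fun h =>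
  hne (P.inf_eq_of_adj h (by have := hu.2; have := hy.2; omega))

/-- Of the `|F| + 1` common neighbours of `u` and `y`, only `v` is not above both. -/
theorem natCard_cov_cov [Finite F] (hu : φ.Cov D x v u) (hy : φ.Cov D x v y)
    (hne : u.1 ⊓ x.1 ≠ y.1 ⊓ x.1) :
    Nat.card {w : φ.Vertex // φ.Cov D x u w ∧ φ.Cov D x y w} = Nat.card F := by
  have : Finite U := Module.finite_of_finite F
  have hfin : Finite φ.Vertex := Subtype.finite
  have hadj := P.not_adj_of_cov hu hy hne
  have hd := P.finrank_inf_of_cov hu hy (fun e => hne (by rw [e])) hadj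
  have h := P.natCard_adj_adj hd
  rw [natCard_split _ (fun w => w = v), natCard_and_eq ⟨hu.1, hy.1⟩, add_comm] at h
  rw [← Nat.add_right_cancel h]
  refine Nat.card_congr (Equiv.subtypeEquivRight fun w => ?_)
  refine ⟨fun hw => ⟨⟨hw.1.1.symm, hw.2.1.symm⟩, ?_⟩, ?_⟩
  · rintro rfl
    have := hw.1.2
    have := hu.2
    omega
  -- a common neighbour of `u` and `y` other than `v` contains neither trace on `x`
  have key : ∀ {u y w : φ.Vertex}, φ.Cov D x v u → φ.Cov D x v y → u.1 ⊓ x.1 ≠ y.1 ⊓ x.1 →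
      ¬ (φ.dualPolarGraph D).Adj u y → finrank F (u.1 ⊓ y.1 : Submodule F U) + 2 = D →
      (φ.dualPolarGraph D).Adj w u → (φ.dualPolarGraph D).Adj w y → w ≠ v → φ.Cov D x u w := by
    intro u y w hu hy hne hadj hd hwu hwy hwv
    -- If `w` contained `u ⊓ x`, then `w ⊓ u` would be `u ⊓ y ⊔ u ⊓ x`, which also lies in `v`. The
    -- triangle `w`, `v`, `y` would put it inside `y`, where it is too large.
    refine P.cov_iff.2 ⟨hwu.symm, fun hle => ?_⟩
    have hN := P.inf_vertex_le_of_adj hd hwu hwy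
    have hNv := P.inf_vertex_le_of_adj hd hu.1 hy.1
    have hlt : u.1 ⊓ y.1 < u.1 ⊓ y.1 ⊔ u.1 ⊓ x.1 := by
      refine lt_of_le_of_ne le_sup_left fun e => hne ?_
      have h1 : u.1 ⊓ x.1 ≤ y.1 ⊓ x.1 :=
        le_inf ((sup_eq_left.1 e.symm).trans inf_le_right) inf_le_right
      exact Submodule.eq_of_le_of_finrank_eq h1 (by have := hu.2; have := hy.2; omega)
    have h1 := Submodule.finrank_lt_finrank_of_lt hlt
    have h2 : u.1 ⊓ y.1 ⊔ u.1 ⊓ x.1 ≤ w.1 ⊓ u.1 :=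
      sup_le (le_inf hN inf_le_left) (le_inf hle inf_le_left)
    have h3 : u.1 ⊓ y.1 ⊔ u.1 ⊓ x.1 ≤ v.1 :=
      sup_le hNv ((P.cov_inf_le hu).trans inf_le_left)
    have h4 := Submodule.eq_of_le_of_finrank_le h2 (by have := hwu.2; omega)
    have hwv' := P.adj_of_le (M := w.1 ⊓ u.1) inf_le_left (h4 ▸ h3) hwu.2 hwv
    have h5 := P.inf_le_of_adj hwv'.1 hwy.symm hy.1.symm
    rw [hwv'.2] at h5
    have h6 := Submodule.finrank_mono (le_inf inf_le_right h5 : w.1 ⊓ u.1 ≤ u.1 ⊓ y.1)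
    have := hwu.2
    omega
  rintro ⟨⟨h1, h2⟩, h3⟩
  refine ⟨key hu hy hne hadj hd h1 h2 h3, key hy hu hne.symm (fun h => hadj h.symm) ?_ h2 h1 h3⟩
  rw [inf_comm]
  exact hd

/-- The intermediate vertices correspond to their traces, which run through the `|F| + 1` subspaces
strictly between `z ⊓ x` and `v ⊓ x`; the trace of `u` is left out. -/
theorem natCard_between [Finite F] (hv : φ.Cov D x v u) (hu : φ.Cov D x u z) :
    Nat.card {u' : φ.Vertex // φ.Cov D x v u' ∧ φ.Cov D x u' z ∧ u'.1 ⊓ x.1 ≠ u.1 ⊓ x.1} =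
      Nat.card F := by
  have : Finite U := Module.finite_of_finite F
  have hfin : Finite φ.Vertex := Subtype.finite
  have hle : z.1 ⊓ x.1 ≤ v.1 ⊓ x.1 := (P.cov_inf_le hu).trans (P.cov_inf_le hv)
  have h1 := hv.2
  have h2 := hu.2
  have h := card_hyperplanes_between hle
  have h3 : finrank F (v.1 ⊓ x.1 : Submodule F U) - finrank F (z.1 ⊓ x.1 : Submodule F U) = 2 := by
    omega
  rw [h3, Finset.sum_range_succ, Finset.sum_range_one, pow_zero, pow_one, add_comm,
    natCard_split _ (fun T => T = u.1 ⊓ x.1),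
    natCard_and_eq ⟨P.cov_inf_le hu, P.cov_inf_le hv, h1.symm⟩, add_comm] at h
  rw [← Nat.add_right_cancel h]
  refine Nat.card_eq_of_bijective (fun a => ⟨a.1.1 ⊓ x.1, ⟨P.cov_inf_le a.2.2.1,
    P.cov_inf_le a.2.1, a.2.1.2.symm⟩, a.2.2.2⟩) ⟨?_, ?_⟩
  · rintro ⟨a, ha⟩ ⟨b, hb⟩ e
    exact Subtype.ext (P.cov_unique ha.2.1 hb.2.1 (congrArg Subtype.val e))
  · rintro ⟨T, ⟨h4, h5, h6⟩, h7⟩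
    obtain ⟨a, ha, hax⟩ := P.exists_cov (h5.trans inf_le_right) h4 (by omega)
    exact ⟨⟨a, P.cov_of_cov_cov hv hu ha (hax ▸ h5.trans inf_le_left), ha, hax ▸ h7⟩,
      Subtype.ext hax⟩

/-- On the line through `y` and `z`, `y` is the only vertex nearest to `x`; the `w` counted are the
vertices other than `y` and `z`. -/
theorem natCard_cov_flat_of_cov [Finite F] (h : φ.Cov D x y z) :
    Nat.card {w : φ.Vertex // φ.Cov D x y w ∧ φ.Flat D x w z} + 1 = s := by
  have : Finite U := Module.finite_of_finite F
  have hfin : Finite φ.Vertex := Subtype.finite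
  rw [← P.natCard_line (inf_le_left : y.1 ⊓ z.1 ≤ y.1) h.1.2,
    natCard_split (fun w : φ.Vertex => y.1 ⊓ z.1 ≤ w.1 ∧ w ≠ y) (fun w => w = z),
    natCard_and_eq (p := fun w : φ.Vertex => y.1 ⊓ z.1 ≤ w.1 ∧ w ≠ y)
      ⟨inf_le_right, h.1.1.symm⟩, add_comm]
  congr 1
  refine Nat.card_congr (Equiv.subtypeEquivRight fun w => ?_)
  refine ⟨fun hw => ⟨⟨P.inf_le_of_adj h.1 hw.1.1.symm hw.2.1, hw.1.1.1.symm⟩, hw.2.1.1⟩, ?_⟩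
  rintro ⟨⟨h1, h2⟩, h3⟩
  have h4 := P.adj_of_le inf_le_left h1 h.1.2 h2.symm
  have h5 := P.adj_of_le h1 inf_le_right h.1.2 h3
  have h6 : φ.Cov D x y w := by
    refine P.cov_iff.2 ⟨h4.1, fun hle => (P.cov_iff.1 h).2 ?_⟩
    exact (le_inf inf_le_left hle).trans (h4.2.le.trans inf_le_right)
  refine ⟨h6, h5.1, ?_⟩
  have := h.2
  have := h6.2
  omega

/-- Here `y` and `z` meet in dimension `D - 2`. Among their `|F| + 1` common neighbours, one with
the trace of `y` must be `u`, and one nearer than `y` would be too far from `z`. -/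
theorem natCard_cov_flat_of_flat [Finite F] (hn : ¬ φ.Cov D x y z) (hu : φ.Cov D x u z)
    (hyu : φ.Flat D x y u) :
    Nat.card {w : φ.Vertex // φ.Cov D x y w ∧ φ.Flat D x w z} = Nat.card F := by
  have : Finite U := Module.finite_of_finite F
  have hfin : Finite φ.Vertex := Subtype.finite
  have h1 := hyu.2
  have h2 := hu.2
  have hnadj : ¬ (φ.dualPolarGraph D).Adj y z := fun h => hn ⟨h, by omega⟩
  have hne : y ≠ z := by rintro rfl; omega
  have hd : finrank F (y.1 ⊓ z.1 : Submodule F U) + 2 = D := by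
    have h1 := Submodule.finrank_sup_add_finrank_inf_eq (u.1 ⊓ y.1) (u.1 ⊓ z.1)
    have h2 := Submodule.finrank_mono
      (sup_le inf_le_left inf_le_left : u.1 ⊓ y.1 ⊔ u.1 ⊓ z.1 ≤ u.1)
    have h3 := Submodule.finrank_mono
      (inf_le_inf inf_le_right inf_le_right : u.1 ⊓ y.1 ⊓ (u.1 ⊓ z.1) ≤ y.1 ⊓ z.1)
    have h4 := hyu.1.symm.2
    have h5 := hu.1.2
    have h6 : finrank F (y.1 ⊓ z.1 : Submodule F U) < finrank F y.1 :=
      Submodule.finrank_lt_finrank_of_lt (lt_of_le_of_ne inf_le_left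
        fun e => hne (P.eq_of_le (inf_eq_left.1 e)))
    have h7 : ¬ finrank F (y.1 ⊓ z.1 : Submodule F U) + 1 = D := fun e => hnadj ⟨hne, e⟩
    rw [P.finrank_eq] at h2 h6
    omega
  have h := P.natCard_adj_adj hd
  rw [natCard_split _ (fun w => w = u), natCard_and_eq ⟨hyu.1.symm, hu.1⟩, add_comm] at h
  rw [← Nat.add_right_cancel h]
  refine Nat.card_congr (Equiv.subtypeEquivRight fun w => ?_)
  constructor
  · rintro ⟨h3, h4⟩
    refine ⟨⟨h3.1.symm, h4.1⟩, ?_⟩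
    rintro rfl
    have := h3.2
    omega
  · rintro ⟨⟨h3, h4⟩, h5⟩
    rcases P.inf_eq_or_cov (x := x) h3 with h6 | h6 | h6
    · have hwz : φ.Cov D x w z := ⟨h4, by rw [h6]; omega⟩
      exact absurd (P.cov_unique hwz hu (h6.trans (P.inf_eq_of_flat hyu))) h5
    · rcases P.inf_eq_or_cov (x := x) h4 with h7 | h7 | h7
      · have := h6.2; rw [h7] at this; omega
      · have := h6.2; have := h7.2; omega
      · have := h6.2; have := h7.2; omega
    · exact ⟨h6, h4, by have := h6.2; omega⟩

/-- Take the `u` below `z` with the trace of `y`. Both `y` and `u` contain that trace together with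
the part of `w ⊓ z` orthogonal to it, a space of dimension at least `D - 1`. -/
theorem exists_cov_flat (hn : ¬ φ.Cov D x y z) (hy : φ.Cov D x y w) (hw : φ.Flat D x w z) :
    ∃ u, φ.Cov D x u z ∧ φ.Flat D x y u := by
  have hwz := P.inf_eq_of_flat hw
  obtain ⟨u, hu, hux⟩ := P.exists_cov (z := z) (T := y.1 ⊓ x.1) inf_le_right
    (hwz ▸ P.cov_inf_le hy) (hwz ▸ hy.2)
  refine ⟨u, hu, ?_, by rw [hux]⟩
  have hne : y ≠ u := by rintro rfl; exact hn hu
  have hT : φ.IsIsotropic (y.1 ⊓ x.1) := P.mono inf_le_right (P.iso x)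
  have h1 := P.finrank_inf_perp (y.1 ⊓ x.1) (P.mono (inf_le_left : w.1 ⊓ z.1 ≤ w.1) (P.iso w))
  have h2 : y.1 ⊓ x.1 ⊓ (w.1 ⊓ z.1) = w.1 ⊓ x.1 := by
    refine le_antisymm (le_inf (inf_le_right.trans inf_le_left) (inf_le_left.trans inf_le_right))
      (le_inf (P.cov_inf_le hy) (le_inf inf_le_left (hwz ▸ inf_le_left)))
  have hyw := P.cov_perp_le hy
  have huz := P.cov_perp_le hu
  rw [hux] at huz
  have h3 : y.1 ⊓ x.1 ⊔ w.1 ⊓ z.1 ⊓ perp (y.1 ⊓ x.1) ≤ y.1 :=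
    sup_le inf_le_left ((inf_le_inf_right _ inf_le_left).trans hyw)
  have h4 : y.1 ⊓ x.1 ⊔ w.1 ⊓ z.1 ⊓ perp (y.1 ⊓ x.1) ≤ u.1 :=
    sup_le (hux ▸ inf_le_left) ((inf_le_inf_right _ inf_le_right).trans huz)
  have h5 := Submodule.finrank_sup_add_finrank_inf_eq (y.1 ⊓ x.1)
    (w.1 ⊓ z.1 ⊓ perp (y.1 ⊓ x.1))
  have h6 : y.1 ⊓ x.1 ⊓ (w.1 ⊓ z.1 ⊓ perp (y.1 ⊓ x.1)) = w.1 ⊓ x.1 := by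
    rw [← inf_assoc, h2, inf_eq_left]
    exact (P.cov_inf_le hy).trans (P.le_perp hT)
  rw [h6] at h5
  rw [h2] at h1
  have h7 := Submodule.finrank_mono (le_inf h3 h4)
  have h8 : finrank F (y.1 ⊓ u.1 : Submodule F U) < finrank F y.1 :=
    Submodule.finrank_lt_finrank_of_lt (lt_of_le_of_ne inf_le_left
      fun e => hne (P.eq_of_le (inf_eq_left.1 e)))
  rw [P.finrank_eq] at h8
  have h9 := hw.1.2
  have h10 := hy.2
  exact ⟨hne, by omega⟩

end Form.IsPolar

end Polar

/-! ### Matrices of relations. -/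

section Indicator

variable {X : Type*}

open Classical in
/-- The 0/1 matrix of a relation. -/
noncomputable def ind (r : X → X → Prop) : Matrix X X ℂ :=
  Matrix.of fun y z => if r y z then 1 else 0

open Classical in
theorem ind_apply (r : X → X → Prop) (y z : X) : ind r y z = if r y z then 1 else 0 := rfl

theorem ind_of {r : X → X → Prop} {y z : X} (h : r y z) : ind r y z = 1 := if_pos h

theorem ind_of_not {r : X → X → Prop} {y z : X} (h : ¬ r y z) : ind r y z = 0 := if_neg h

theorem ind_transpose (r : X → X → Prop) : (ind r).transpose = ind fun y z => r z y := rfl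

theorem ind_mul_ind [Fintype X] (r r' : X → X → Prop) (y z : X) :
    (ind r * ind r') y z = (Nat.card {w // r y w ∧ r' w z} : ℂ) := by
  classical
  simp only [Matrix.mul_apply, ind_apply, ← ite_and, mul_ite, mul_one, mul_zero]
  rw [Nat.card_eq_fintype_card, Fintype.card_subtype, Finset.card_filter]
  push_cast
  exact Finset.sum_congr rfl fun w _ => if_congr and_comm rfl rfl

theorem natCard_zero {p : X → Prop} (h : ∀ w, ¬ p w) : Nat.card {w // p w} = 0 :=
  have : IsEmpty {w // p w} := ⟨fun w => h w.1 w.2⟩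
  Nat.card_of_isEmpty

end Indicator

/-! ### Matrix products as path counts. -/

section Polar

variable {F U : Type*} [Field F] [Finite F] [AddCommGroup U] [Module F U] [FiniteDimensional F U]

namespace Form

variable (φ : Form F U) (D : ℕ) (x : φ.Vertex)

/-- The number of vertices above `y`. -/
noncomputable def upDegree (y : φ.Vertex) : ℂ := (Nat.card {w : φ.Vertex // φ.Cov D x y w} : ℂ)

open Classical in
/-- The part of `R * L` between vertices with the same trace on `x`. -/
noncomputable def traceRL : Matrix φ.Vertex φ.Vertex ℂ :=
  Matrix.of fun y z => if y.1 ⊓ x.1 = z.1 ⊓ x.1 then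
    (Nat.card {v : φ.Vertex // φ.Cov D x v y ∧ φ.Cov D x v z} : ℂ) else 0

end Form

namespace Form.IsPolar

variable {φ : Form F U} {D s : ℕ}
  {perp : Submodule F U → Submodule F U} (P : φ.IsPolar D s perp) (x : φ.Vertex)
include P

theorem lowering_eq : lowering (φ.dualPolarGraph D) x = ind (φ.Cov D x) := by
  have h : (fun y z => (φ.dualPolarGraph D).Adj y z ∧
      (φ.dualPolarGraph D).dist x z = (φ.dualPolarGraph D).dist x y + 1) = φ.Cov D x := by
    funext y z
    refine propext (and_congr_right fun _ => ?_)
    have h1 := (P.dist_add x y).2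
    have h2 := (P.dist_add x z).2
    omega
  rw [← h]
  ext y z
  simp only [lowering, Matrix.of_apply, ind_apply]
  congr

theorem flattening_eq : flattening (φ.dualPolarGraph D) x = ind (φ.Flat D x) := by
  have h : (fun y z => (φ.dualPolarGraph D).Adj y z ∧
      (φ.dualPolarGraph D).dist x z = (φ.dualPolarGraph D).dist x y) = φ.Flat D x := by
    funext y z
    refine propext (and_congr_right fun _ => ?_)
    have h1 := (P.dist_add x y).2
    have h2 := (P.dist_add x z).2
    omega
  rw [← h]
  ext y z
  simp only [flattening, Matrix.of_apply, ind_apply]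
  congr

theorem raising_eq : raising (φ.dualPolarGraph D) x = (ind (φ.Cov D x)).transpose := by
  have h : (fun y z => (φ.dualPolarGraph D).Adj y z ∧
      (φ.dualPolarGraph D).dist x z + 1 = (φ.dualPolarGraph D).dist x y) =
      fun y z => φ.Cov D x z y := by
    funext y z
    refine propext (and_congr ((φ.dualPolarGraph D).adj_comm y z) ?_)
    have h1 := (P.dist_add x y).2
    have h2 := (P.dist_add x z).2
    omega
  rw [ind_transpose, ← h]
  ext y z
  simp only [raising, Matrix.of_apply, ind_apply]
  congr

/-- If `y` is below `z`, the path counts are `s - 1` and `0`. If instead some `u` below `z` is flat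
to `y`, they are `|F|` and `1`. Otherwise both vanish. -/
theorem lowering_mul_flattening_apply (y z : φ.Vertex) :
    (ind (φ.Cov D x) * ind (φ.Flat D x) - (Nat.card F : ℂ) • (ind (φ.Flat D x) * ind (φ.Cov D x)))
      y z = ((s : ℂ) - 1) * ind (φ.Cov D x) y z := by
  rw [Matrix.sub_apply, Matrix.smul_apply, ind_mul_ind, ind_mul_ind, smul_eq_mul]
  by_cases h : φ.Cov D x y z
  · rw [ind_of h, natCard_zero (p := fun w => φ.Flat D x y w ∧ φ.Cov D x w z) ?_,
      ← P.natCard_cov_flat_of_cov h]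
    · push_cast; ring
    · rintro w ⟨h1, h2⟩
      exact h1.1.1 (P.cov_unique h h2 (P.inf_eq_of_flat h1))
  · rw [ind_of_not h]
    by_cases hu : ∃ u, φ.Cov D x u z ∧ φ.Flat D x y u
    · obtain ⟨u, hu, hyu⟩ := hu
      have h1 : Nat.card {w // φ.Flat D x y w ∧ φ.Cov D x w z} = 1 := by
        rw [← natCard_and_eq (p := fun w => φ.Flat D x y w ∧ φ.Cov D x w z) ⟨hyu, hu⟩]
        exact Nat.card_congr (Equiv.subtypeEquivRight fun w => ⟨fun hw => ⟨hw, P.cov_unique hw.2 hu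
          ((P.inf_eq_of_flat hw.1).symm.trans (P.inf_eq_of_flat hyu))⟩, fun hw => hw.1⟩)
      rw [h1, P.natCard_cov_flat_of_flat h hu hyu]
      push_cast; ring
    · rw [natCard_zero (p := fun w => φ.Flat D x y w ∧ φ.Cov D x w z) fun w hw =>
        hu ⟨w, hw.2, hw.1⟩, natCard_zero (p := fun w => φ.Cov D x y w ∧ φ.Flat D x w z) fun w hw =>
        hu (P.exists_cov_flat h hw.1 hw.2)]
      simp

/-- Distinct vertices with equal traces have no common upper neighbour by `cov_unique`, which is why
`traceRL` is subtracted. -/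
theorem lowering_mul_raising : ind (φ.Cov D x) * (ind (φ.Cov D x)).transpose =
    (Nat.card F : ℂ) • ((ind (φ.Cov D x)).transpose * ind (φ.Cov D x) - φ.traceRL D x) +
      Matrix.diagonal (φ.upDegree D x) := by
  ext y z
  rw [Matrix.add_apply, Matrix.smul_apply, Matrix.sub_apply, ind_transpose, ind_mul_ind,
    ind_mul_ind, traceRL, Matrix.of_apply, smul_eq_mul]
  by_cases hyz : y = z
  · subst hyz
    rw [Matrix.diagonal_apply_eq, if_pos rfl]
    simp [upDegree]
  rw [Matrix.diagonal_apply_ne _ hyz, add_zero]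
  by_cases hx : y.1 ⊓ x.1 = z.1 ⊓ x.1
  · rw [if_pos hx, sub_self, mul_zero, natCard_zero, Nat.cast_zero]
    exact fun w hw => hyz (P.cov_unique hw.1 hw.2 hx)
  rw [if_neg hx, sub_zero]
  by_cases hv : ∃ v, φ.Cov D x v y ∧ φ.Cov D x v z
  · obtain ⟨v, h1, h2⟩ := hv
    rw [P.natCard_cov_cov h1 h2 hx]
    have h3 : Nat.card {w // φ.Cov D x w y ∧ φ.Cov D x w z} = 1 := by
      rw [← natCard_and_eq (p := fun w => φ.Cov D x w y ∧ φ.Cov D x w z) ⟨h1, h2⟩]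
      exact Nat.card_congr (Equiv.subtypeEquivRight fun w => ⟨fun hw => ⟨hw,
        P.meet_unique hw.1 hw.2 h1 h2 hx⟩, fun hw => hw.1⟩)
    rw [h3]
    push_cast; ring
  · rw [natCard_zero fun w hw => hv ⟨w, hw⟩, natCard_zero fun w hw => hv (P.exists_meet hw.1 hw.2 hx)]
    simp

/-- The vertices above both `y` and `v` with the same trace on `x` as `z`. -/
theorem natCard_cov_cov_inf_eq {y z v : φ.Vertex} (hle : z.1 ⊓ x.1 ≤ y.1 ⊓ x.1)
    (hf : finrank F (y.1 ⊓ x.1 : Submodule F U) = finrank F (z.1 ⊓ x.1 : Submodule F U) + 1)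
    (hv : φ.Cov D x v z) (hvy : v ≠ y) :
    Nat.card {w : φ.Vertex // φ.Cov D x y w ∧ φ.Cov D x v w ∧ w.1 ⊓ x.1 = z.1 ⊓ x.1} =
      Nat.card F * Nat.card {t : φ.Vertex //
        (φ.Cov D x t y ∧ φ.Cov D x t v) ∧ v.1 ⊓ x.1 ≠ y.1 ⊓ x.1} := by
  by_cases hx : v.1 ⊓ x.1 = y.1 ⊓ x.1
  · rw [natCard_zero fun w hw => hvy (P.cov_unique hw.2.1 hw.1 hx),
      natCard_zero fun w hw => hw.2 hx, mul_zero]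
  have h1 : ∀ w, (φ.Cov D x y w ∧ φ.Cov D x v w ∧ w.1 ⊓ x.1 = z.1 ⊓ x.1) ↔
      (φ.Cov D x y w ∧ φ.Cov D x v w) := by
    refine fun w => ⟨fun h => ⟨h.1, h.2.1⟩, fun h => ⟨h.1, h.2, ?_⟩⟩
    refine (Submodule.eq_of_le_of_finrank_eq ?_ ?_).symm
    · rw [P.inf_eq_inf_inf h.1 h.2 (Ne.symm hx)]
      exact le_inf hle (P.cov_inf_le hv)
    · have := h.1.2
      omega
  rw [Nat.card_congr (Equiv.subtypeEquivRight h1)]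
  by_cases ht : ∃ t, φ.Cov D x t y ∧ φ.Cov D x t v
  · obtain ⟨t, h2, h3⟩ := ht
    have h4 : Nat.card {t : φ.Vertex //
        (φ.Cov D x t y ∧ φ.Cov D x t v) ∧ v.1 ⊓ x.1 ≠ y.1 ⊓ x.1} = 1 := by
      rw [← natCard_and_eq (p := fun w => φ.Cov D x w y ∧ φ.Cov D x w v) ⟨h2, h3⟩]
      exact Nat.card_congr (Equiv.subtypeEquivRight fun w => ⟨fun hw => ⟨hw.1,
        P.meet_unique hw.1.1 hw.1.2 h2 h3 (Ne.symm hx)⟩, fun hw => ⟨hw.1, hx⟩⟩)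
    rw [h4, P.natCard_cov_cov h2 h3 (Ne.symm hx), mul_one]
  · rw [natCard_zero fun w hw => ht (P.exists_meet hw.1 hw.2 (Ne.symm hx)),
      natCard_zero fun w hw => ht ⟨w, hw.1⟩, mul_zero]

open Classical in
theorem lowering_mul_traceRL_apply {y z u : φ.Vertex} (hu : φ.Cov D x u z)
    (hux : u.1 ⊓ x.1 = y.1 ⊓ x.1) :
    (ind (φ.Cov D x) * φ.traceRL D x) y z =
      (if φ.Cov D x y z then
        (Nat.card {w : φ.Vertex // φ.Cov D x y w ∧ w.1 ⊓ x.1 = z.1 ⊓ x.1} : ℂ) else 0) +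
      (Nat.card F : ℂ) ^ 2 * Nat.card {v : φ.Vertex // φ.Cov D x v y ∧ φ.Cov D x v u} := by
  have hle : z.1 ⊓ x.1 ≤ y.1 ⊓ x.1 := hux ▸ P.cov_inf_le hu
  have hf : finrank F (y.1 ⊓ x.1 : Submodule F U) =
      finrank F (z.1 ⊓ x.1 : Submodule F U) + 1 := hux ▸ hu.2
  have hsum : ∀ (p : φ.Vertex → Prop) [DecidablePred p],
      (Nat.card {w // p w} : ℂ) = ∑ w, if p w then 1 else 0 := by
    intro p _
    rw [Nat.card_eq_fintype_card, Fintype.card_subtype, Finset.card_filter]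
    push_cast
    rfl
  -- sum over the vertex `v` below both `w` and `z` first
  have h1 : (ind (φ.Cov D x) * φ.traceRL D x) y z = ∑ v, if φ.Cov D x v z then
      (Nat.card {w : φ.Vertex // φ.Cov D x y w ∧ φ.Cov D x v w ∧ w.1 ⊓ x.1 = z.1 ⊓ x.1} : ℂ)
      else 0 := by
    rw [Matrix.mul_apply]
    simp only [traceRL, Matrix.of_apply, ind_apply, hsum]
    simp only [ite_mul, one_mul, zero_mul]
    have h2 : ∀ (p : Prop) [Decidable p] (f : φ.Vertex → ℂ),
        (if p then ∑ v, f v else 0) = ∑ v, if p then f v else 0 := by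
      intro p _ f
      split_ifs <;> simp
    simp only [h2]
    rw [Finset.sum_comm]
    refine Finset.sum_congr rfl fun v _ => Finset.sum_congr rfl fun w _ => ?_
    split_ifs <;> tauto
  -- The term `v = y` is kept apart; for other `v`, the upper vertices `w` are traded for `|F|`
  -- times the lower vertices `t`.
  have h2 : ∀ v, (if φ.Cov D x v z then
      (Nat.card {w : φ.Vertex // φ.Cov D x y w ∧ φ.Cov D x v w ∧ w.1 ⊓ x.1 = z.1 ⊓ x.1} : ℂ)
      else 0) = (if v = y then if φ.Cov D x y z then
        (Nat.card {w : φ.Vertex // φ.Cov D x y w ∧ w.1 ⊓ x.1 = z.1 ⊓ x.1} : ℂ) else 0 else 0) +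
      (Nat.card F : ℂ) * ∑ t, if φ.Cov D x t y then
        if φ.Cov D x t v ∧ φ.Cov D x v z ∧ v.1 ⊓ x.1 ≠ u.1 ⊓ x.1 then (1 : ℂ) else 0 else 0 := by
    intro v
    by_cases hvz : φ.Cov D x v z
    · rw [if_pos hvz]
      by_cases hvy : v = y
      · subst hvy
        rw [if_pos rfl, if_pos hvz]
        simp only [hux, ne_eq, not_true, and_false, if_false, ite_self, Finset.sum_const_zero,
          mul_zero, add_zero]
        norm_cast
        exact Nat.card_congr (Equiv.subtypeEquivRight fun w =>
          ⟨fun h => ⟨h.1, h.2.2⟩, fun h => ⟨h.1, h.1, h.2⟩⟩)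
      · rw [P.natCard_cov_cov_inf_eq x hle hf hvz hvy, if_neg hvy, zero_add, Nat.cast_mul, hsum]
        congr 1
        refine Finset.sum_congr rfl fun t _ => ?_
        rw [hux]
        split_ifs <;> tauto
    · rw [if_neg hvz, eq_comm]
      have h3 : ∀ t, ¬ (φ.Cov D x t v ∧ φ.Cov D x v z ∧ v.1 ⊓ x.1 ≠ u.1 ⊓ x.1) :=
        fun t h => hvz h.2.1
      simp only [h3, if_false, ite_self, Finset.sum_const_zero, mul_zero, add_zero]
      split_ifs with h4 h5
      · exact absurd (h4 ▸ h5) hvz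
      · rfl
      · rfl
  rw [h1, Finset.sum_congr rfl fun v _ => h2 v, Finset.sum_add_distrib, Finset.sum_ite_eq',
    if_pos (Finset.mem_univ _), ← Finset.mul_sum, Finset.sum_comm, sq, mul_assoc,
    hsum fun v => φ.Cov D x v y ∧ φ.Cov D x v u]
  congr 2
  rw [Finset.mul_sum]
  refine Finset.sum_congr rfl fun t _ => ?_
  by_cases hty : φ.Cov D x t y
  · simp only [hty, if_true, true_and]
    rw [← hsum]
    -- The vertices `v` between `t` and `z` are `|F|` in number if `t` is below `u`. If it is not,
    -- there are none, since one such `v` would force `t` below `u`.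
    by_cases htu : φ.Cov D x t u
    · rw [P.natCard_between htu hu, if_pos htu, mul_one]
    · rw [if_neg htu, mul_zero, natCard_zero, Nat.cast_zero]
      exact fun v hv => htu (P.cov_of_cov_cov hv.1 hv.2.1 hu
        (hux ▸ (P.cov_inf_le hty).trans inf_le_left))
  · simp [hty]

theorem traceRL_mul_lowering_apply {y z u : φ.Vertex} (hu : φ.Cov D x u z)
    (hux : u.1 ⊓ x.1 = y.1 ⊓ x.1) :
    (φ.traceRL D x * ind (φ.Cov D x)) y z =
      Nat.card {v : φ.Vertex // φ.Cov D x v y ∧ φ.Cov D x v u} := by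
  rw [Matrix.mul_apply, Finset.sum_eq_single u]
  · rw [ind_of hu, traceRL, Matrix.of_apply, if_pos hux.symm, mul_one]
  · intro w _ hw
    by_cases hwz : φ.Cov D x w z
    · rw [traceRL, Matrix.of_apply, if_neg, zero_mul]
      exact fun e => hw (P.cov_unique hwz hu (e.symm.trans hux.symm))
    · rw [ind_of_not hwz, mul_zero]
  · exact fun h => absurd (Finset.mem_univ _) h

/-- The terms in `|F| ^ 2` cancel between the two products with `traceRL`, so only pairs with `y`
below `z` contribute, through degrees. -/
theorem traceRL_commutator :
    (Nat.card F : ℂ) ^ 2 • (φ.traceRL D x * ind (φ.Cov D x)) - ind (φ.Cov D x) * φ.traceRL D x -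
      (Nat.card F : ℂ) • (Matrix.diagonal (φ.upDegree D x) * ind (φ.Cov D x)) +
      (Nat.card F : ℂ)⁻¹ • (ind (φ.Cov D x) * Matrix.diagonal (φ.upDegree D x)) =
      -(((Nat.card F : ℂ) + 1) * s * (Nat.card F : ℂ) ^ D / Nat.card F) • ind (φ.Cov D x) := by
  classical
  ext y z
  simp only [Matrix.add_apply, Matrix.sub_apply, Matrix.smul_apply, smul_eq_mul,
    Matrix.diagonal_mul, Matrix.mul_diagonal]
  by_cases hu : ∃ u, φ.Cov D x u z ∧ u.1 ⊓ x.1 = y.1 ⊓ x.1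
  · obtain ⟨u, hu, hux⟩ := hu
    rw [P.lowering_mul_traceRL_apply x hu hux, P.traceRL_mul_lowering_apply x hu hux]
    by_cases h : φ.Cov D x y z
    · rw [if_pos h, ind_of h]
      have hb : 1 < Nat.card F := Finite.one_lt_card
      have h1 := P.natCard_cov (x := x) (y := y)
      have h2 := P.natCard_cov (x := x) (y := z)
      have h3 := P.natCard_cov_inf_eq (P.cov_inf_le h) h.2
      have hle := P.finrank_le (P.mono (inf_le_left : y.1 ⊓ x.1 ≤ y.1) (P.iso y))
      have h4 := h.2
      -- With `b = |F|` and `[n] = (b ^ n - 1) / (b - 1)`, the three counts are `s ([D] - [k])`, `s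
      -- ([D] - [k+1])` and `s b ^ k`; in their combination `k` drops out.
      obtain ⟨k, hk⟩ : ∃ k, D = finrank F (y.1 ⊓ x.1 : Submodule F U) + k :=
        Nat.exists_eq_add_of_le hle
      have hk1 : D - finrank F (y.1 ⊓ x.1 : Submodule F U) = k := by omega
      have hk2 : D - finrank F (z.1 ⊓ x.1 : Submodule F U) = k + 1 := by omega
      rw [hk1] at h1
      rw [hk2] at h2
      rw [hk1, hk2] at h3
      have geo : ∀ n, (∑ i ∈ Finset.range n, (Nat.card F : ℂ) ^ i) * ((Nat.card F : ℂ) - 1) =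
          (Nat.card F : ℂ) ^ n - 1 := fun n => geom_sum_mul _ n
      have hb0 : (Nat.card F : ℂ) ≠ 0 := by
        have : Nat.card F ≠ 0 := by omega
        exact_mod_cast this
      have hb1 : (Nat.card F : ℂ) - 1 ≠ 0 := by
        rw [sub_ne_zero]
        have : Nat.card F ≠ 1 := by omega
        exact_mod_cast this
      have e1 := congrArg (Nat.cast : ℕ → ℂ) h1
      have e2 := congrArg (Nat.cast : ℕ → ℂ) h2
      have e3 := congrArg (Nat.cast : ℕ → ℂ) h3
      push_cast at e1 e2 e3
      have gk := geo k
      have gD := geo D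
      rw [Finset.sum_range_succ] at e2 e3
      unfold upDegree
      generalize (Nat.card {w // φ.Cov D x y w} : ℂ) = B at *
      generalize (Nat.card {w // φ.Cov D x z w} : ℂ) = B' at *
      generalize (Nat.card {w // φ.Cov D x y w ∧ w.1 ⊓ x.1 = z.1 ⊓ x.1} : ℂ) = β at *
      generalize ∑ i ∈ Finset.range k, (Nat.card F : ℂ) ^ i = hk at *
      generalize ∑ i ∈ Finset.range D, (Nat.card F : ℂ) ^ i = hD at *
      generalize (Nat.card F : ℂ) = b at *
      obtain rfl := eq_sub_of_add_eq e1
      obtain rfl := eq_sub_of_add_eq e2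
      obtain rfl := eq_sub_of_add_eq e3
      obtain e4 := eq_add_of_sub_eq gk.symm
      obtain e5 := eq_add_of_sub_eq gD.symm
      rw [e4, e5]
      field_simp
      ring
    · rw [if_neg h, ind_of_not h]
      ring
  · have h1 : ¬ φ.Cov D x y z := fun h => hu ⟨y, h, rfl⟩
    have h2 : (φ.traceRL D x * ind (φ.Cov D x)) y z = 0 := by
      rw [Matrix.mul_apply]
      refine Finset.sum_eq_zero fun w _ => ?_
      by_cases hw : φ.Cov D x w z
      · rw [traceRL, Matrix.of_apply, if_neg fun e => hu ⟨w, hw, e.symm⟩, zero_mul]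
      · rw [ind_of_not hw, mul_zero]
    have h3 : (ind (φ.Cov D x) * φ.traceRL D x) y z = 0 := by
      rw [Matrix.mul_apply]
      refine Finset.sum_eq_zero fun w _ => ?_
      by_cases hw : φ.Cov D x y w
      · rw [traceRL, Matrix.of_apply, if_neg, mul_zero]
        intro e
        obtain ⟨u, hu', hux⟩ := P.exists_cov (z := z) (T := y.1 ⊓ x.1) inf_le_right
          (e ▸ P.cov_inf_le hw) (e ▸ hw.2)
        exact hu ⟨u, hu', hux⟩
      · rw [ind_of_not hw, zero_mul]
    rw [h2, h3, ind_of_not h1]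
    ring

end Form.IsPolar

end Polar

/-! ### The polar axioms from a reflexive form. -/

section Reflexive

variable {F U : Type*} [Field F] [AddCommGroup U] [Module F U] {σ : F →+* F}

/-- The vectors orthogonal to all of `W`. -/
def perpOf (H : U →ₛₗ[σ] U →ₗ[F] F) (W : Submodule F U) : Submodule F U where
  carrier := {v | ∀ w ∈ W, H w v = 0}
  add_mem' ha hb w hw := by rw [map_add, ha w hw, hb w hw, add_zero]
  zero_mem' w _ := map_zero _
  smul_mem' c v hv w hw := by rw [map_smul, hv w hw, smul_zero]

/-- The isotropic subspaces of `φ` are those that consist of mutually `H`-orthogonal vectors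
satisfying `S`, where `H` is reflexive and its radical meets `S` trivially. -/
structure Form.IsReflexive (φ : Form F U) (H : U →ₛₗ[σ] U →ₗ[F] F) (S : U → Prop) : Prop where
  isotropic_iff {W : Submodule F U} :
    φ.IsIsotropic W ↔ (∀ w ∈ W, S w) ∧ ∀ v ∈ W, ∀ w ∈ W, H v w = 0
  symm {v w : U} : H v w = 0 → H w v = 0
  add {v w : U} : S v → S w → H v w = 0 → S (v + w)
  smul {v : U} (c : F) : S v → S (c • v)
  self {v : U} : S v → H v v = 0
  eq_zero {v : U} : S v → (∀ w, H v w = 0) → v = 0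

/-- Orthogonality to `C` amounts to one linear equation for each vector of a basis of `C`. -/
theorem finrank_le_inf_perpOf [FiniteDimensional F U] (H : U →ₛₗ[σ] U →ₗ[F] F)
    (C x : Submodule F U) :
    finrank F x ≤ finrank F (x ⊓ perpOf H C : Submodule F U) + finrank F C := by
  let b := finBasis F C
  let f : U →ₗ[F] (Fin (finrank F C) → F) := LinearMap.pi fun i => H (b i).1
  have hker : LinearMap.ker (f.domRestrict x) = (x ⊓ perpOf H C).submoduleOf x := by
    ext ⟨v, hv⟩
    rw [LinearMap.mem_ker]
    change _ ↔ v ∈ x ⊓ perpOf H C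
    constructor
    · intro h
      refine ⟨hv, fun w hw => ?_⟩
      have hs : (⟨w, hw⟩ : C) ∈ Submodule.span F (Set.range b) := by
        rw [b.span_eq]; exact Submodule.mem_top
      have : ∀ c ∈ Submodule.span F (Set.range b), H c.1 v = 0 := by
        intro c hc
        induction hc using Submodule.span_induction with
        | mem c hc =>
          obtain ⟨i, rfl⟩ := hc
          exact congrFun h i
        | zero => simp
        | add c d _ _ hc hd => simp [hc, hd]
        | smul a c _ hc => simp [hc]
      exact this _ hs
    · intro h
      funext i
      exact h.2 _ (b i).2
  have h1 := LinearMap.finrank_range_add_finrank_ker (f.domRestrict x)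
  rw [hker, (Submodule.submoduleOfEquivOfLe (inf_le_left : x ⊓ perpOf H C ≤ x)).finrank_eq] at h1
  have h2 := Submodule.finrank_le (LinearMap.range (f.domRestrict x))
  rw [finrank_fin_fun] at h2
  omega

theorem natCard_affine {W : Submodule F U} {f : U →ₗ[F] F} {s₀ : U} (h : s₀ ∈ W) (h' : f s₀ = 1) :
    Nat.card {s : U // s ∈ W ∧ f s = 1} = Nat.card (W ⊓ LinearMap.ker f : Submodule F U) := by
  refine Nat.card_congr
    { toFun := fun s => ⟨s.1 - s₀, W.sub_mem s.2.1 h, ?_⟩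
      invFun := fun v => ⟨v.1 + s₀, W.add_mem v.2.1 h, ?_⟩
      left_inv := fun s => Subtype.ext (sub_add_cancel _ _)
      right_inv := fun v => Subtype.ext (add_sub_cancel_right _ _) }
  · rw [SetLike.mem_coe, LinearMap.mem_ker, map_sub, s.2.2, h', sub_self]
  · have := v.2.2
    rw [SetLike.mem_coe, LinearMap.mem_ker] at this
    rw [map_add, this, h', zero_add]

namespace Form.IsReflexive

variable [FiniteDimensional F U] {φ : Form F U} {H : U →ₛₗ[σ] U →ₗ[F] F} {S : U → Prop}
  (A : φ.IsReflexive H S)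
include A

theorem mono {W W' : Submodule F U} (h : W ≤ W') (h' : φ.IsIsotropic W') : φ.IsIsotropic W := by
  rw [A.isotropic_iff] at h' ⊢
  exact ⟨fun w hw => h'.1 w (h hw), fun v hv w hw => h'.2 v (h hv) w (h hw)⟩

theorem perp_symm {W W' : Submodule F U} (h : W ≤ perpOf H W') : W' ≤ perpOf H W :=
  fun _ hv _ hw => A.symm (h hw _ hv)

theorem le_perp {W : Submodule F U} (h : φ.IsIsotropic W) : W ≤ perpOf H W :=
  fun v hv w hw => (A.isotropic_iff.1 h).2 w hw v hv

theorem sup {W W' : Submodule F U} (h : φ.IsIsotropic W) (h' : φ.IsIsotropic W')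
    (hp : W ≤ perpOf H W') : φ.IsIsotropic (W ⊔ W') := by
  have hp' := A.perp_symm hp
  rw [A.isotropic_iff] at h h' ⊢
  constructor
  · intro v hv
    obtain ⟨a, ha, b, hb, rfl⟩ := Submodule.mem_sup.1 hv
    exact A.add (h.1 a ha) (h'.1 b hb) (hp' hb a ha)
  · intro v hv w hw
    obtain ⟨a, ha, b, hb, rfl⟩ := Submodule.mem_sup.1 hv
    obtain ⟨c, hc, d, hd, rfl⟩ := Submodule.mem_sup.1 hw
    simp only [map_add, LinearMap.add_apply, h.2 a ha c hc, h'.2 b hb d hd, hp' hd a ha,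
      hp hc b hb, add_zero]

theorem span_singleton {v : U} (h : S v) : φ.IsIsotropic (F ∙ v) := by
  rw [A.isotropic_iff]
  constructor
  · intro w hw
    obtain ⟨c, rfl⟩ := Submodule.mem_span_singleton.1 hw
    exact A.smul c h
  · intro w hw w' hw'
    obtain ⟨c, rfl⟩ := Submodule.mem_span_singleton.1 hw
    obtain ⟨d, rfl⟩ := Submodule.mem_span_singleton.1 hw'
    simp [A.self h]

/-- Vectors of `x` are already orthogonal to `M ⊓ x`, so only a complement of it in `M` imposes
conditions. -/
theorem finrank_inf_perp (M : Submodule F U) {x : Submodule F U} (hx : φ.IsIsotropic x) :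
    finrank F x + finrank F (M ⊓ x : Submodule F U) ≤
      finrank F (x ⊓ perpOf H M : Submodule F U) + finrank F M := by
  obtain ⟨C, hC⟩ := Submodule.exists_isCompl ((M ⊓ x).submoduleOf M)
  have h1 := Submodule.finrank_add_eq_of_isCompl hC
  rw [(Submodule.submoduleOfEquivOfLe (inf_le_left : M ⊓ x ≤ M)).finrank_eq] at h1
  have h2 := finrank_le_inf_perpOf H (C.map M.subtype) x
  rw [(Submodule.equivMapOfInjective M.subtype M.injective_subtype C).finrank_eq.symm] at h2
  have h3 : x ⊓ perpOf H (C.map M.subtype) ≤ x ⊓ perpOf H M := by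
    refine le_inf inf_le_left fun v hv w hw => ?_
    have h4 : (⟨w, hw⟩ : M) ∈ (M ⊓ x).submoduleOf M ⊔ C := by
      rw [hC.sup_eq_top]; exact Submodule.mem_top
    obtain ⟨a, ha, b, hb, hab⟩ := Submodule.mem_sup.1 h4
    have hab : (a : U) + b = w := congrArg Subtype.val hab
    rw [← hab, map_add, LinearMap.add_apply, A.le_perp hx hv.1 a ha.2,
      hv.2 b ⟨b, hb, rfl⟩, add_zero]
  have := Submodule.finrank_mono h3
  omega

/-- By maximality the part of `W'` orthogonal to `W` lies in `W ⊓ W'`; the previous bound does the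
rest. -/
theorem finrank_le_of_maximal {W W' : Submodule F U} (h : Maximal φ.IsIsotropic W)
    (h' : φ.IsIsotropic W') : finrank F W' ≤ finrank F W := by
  have h1 := A.finrank_inf_perp W h'
  have h2 : φ.IsIsotropic (W' ⊓ perpOf H W ⊔ W) :=
    A.sup (A.mono inf_le_left h') h.prop inf_le_right
  have h3 : W' ⊓ perpOf H W ≤ W := le_sup_left.trans (h.le_of_ge h2 le_sup_right)
  have h4 := Submodule.finrank_mono (le_inf h3 inf_le_left : W' ⊓ perpOf H W ≤ W ⊓ W')
  omega

/-- The form may have a radical (odd-dimensional quadratic forms in characteristic 2), but it meets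
the singular vectors trivially, so `w ↦ H w` is injective on `W`. This map is only semilinear, hence
the comparison of cardinalities. -/
theorem finrank_perpOf [Finite F] {W : Submodule F U} (h : φ.IsIsotropic W) :
    finrank F (perpOf H W) + finrank F W = finrank F U := by
  have h1 := finrank_le_inf_perpOf H W ⊤
  rw [top_inf_eq, finrank_top] at h1
  have h2 := Subspace.finrank_add_finrank_dualAnnihilator_eq (perpOf H W)
  refine le_antisymm ?_ h1
  rw [← h2, Nat.add_le_add_iff_left]
  have : Finite (Dual F U) := Module.finite_of_finite F
  have h3 : Nat.card W ≤ Nat.card (perpOf H W).dualAnnihilator := by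
    refine Nat.card_le_card_of_injective
      (fun w => ⟨H w.1, (Submodule.mem_dualAnnihilator _).2 fun v hv => hv w.1 w.2⟩)
      fun a b e => ?_
    have e : H a.1 = H b.1 := congrArg Subtype.val e
    refine sub_eq_zero.1 (Subtype.ext (A.eq_zero ((A.isotropic_iff.1 h).1 _ (a - b).2) ?_))
    intro w
    rw [Submodule.coe_sub, map_sub, e, sub_self, LinearMap.zero_apply]
  rw [Module.natCard_eq_pow_finrank (K := F) (V := W),
    Module.natCard_eq_pow_finrank (K := F) (V := (perpOf H W).dualAnnihilator)] at h3
  exact (Nat.pow_le_pow_iff_right Finite.one_lt_card).1 h3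

/-- A complement of `W` in its orthogonal space contains no nonzero singular vector, as such a
vector would enlarge `W`. -/
theorem finrank_lt_of_maximal [Finite F] {k : ℕ}
    (hk : ∀ B : Submodule F U, k ≤ finrank F B → ∃ v ∈ B, v ≠ 0 ∧ S v) {W : Submodule F U}
    (h : Maximal φ.IsIsotropic W) : finrank F U < 2 * finrank F W + k := by
  by_contra! hlt
  have h1 := A.finrank_perpOf h.prop
  have hle := A.le_perp h.prop
  obtain ⟨C, hC⟩ := Submodule.exists_isCompl (W.submoduleOf (perpOf H W))
  have h2 := Submodule.finrank_add_eq_of_isCompl hC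
  rw [(Submodule.submoduleOfEquivOfLe hle).finrank_eq] at h2
  obtain ⟨v, hv, hv0, hSv⟩ := hk (C.map (perpOf H W).subtype) (by
    rw [(Submodule.equivMapOfInjective _ (perpOf H W).injective_subtype C).finrank_eq.symm]
    omega)
  obtain ⟨c, hc, rfl⟩ := hv
  have h3 : φ.IsIsotropic ((F ∙ (c : U)) ⊔ W) :=
    A.sup (A.span_singleton hSv) h.prop ((Submodule.span_singleton_le_iff_mem _ _).2 c.2)
  have h4 : (c : U) ∈ W :=
    h.le_of_ge h3 le_sup_right (Submodule.mem_sup_left (Submodule.mem_span_singleton_self _))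
  have h5 : c ∈ W.submoduleOf (perpOf H W) ⊓ C := ⟨h4, hc⟩
  rw [hC.inf_eq_bot, Submodule.mem_bot] at h5
  exact hv0 (by rw [h5]; rfl)

/-- Fix `p` in `y` outside `M` and count the singular `s` orthogonal to `M` with `H p s = 1` in two
ways: along the direction `p`, and by the space that `s` spans with `M`. -/
theorem natCard_line [Finite F] {D τ : ℕ} (hD : ∀ W, φ.IsIsotropic W → finrank F W ≤ D)
    (hτ : ∀ p s : U, S p → H p s = 1 → Nat.card {c : F // S (s + c • p)} = τ)
    {M y : Submodule F U} (hy : φ.IsIsotropic y) (hf : finrank F y = D) (hMy : M ≤ y)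
    (hM : finrank F M + 1 = D) :
    Nat.card {w : Submodule F U // φ.IsIsotropic w ∧ finrank F w = D ∧ M ≤ w ∧ w ≠ y} *
      Nat.card F ^ (2 * D) = Nat.card F ^ finrank F U * τ := by
  have hU : Finite U := Module.finite_of_finite F
  obtain ⟨p, hpy, hpM⟩ := SetLike.exists_of_lt
    (lt_of_le_of_ne hMy fun e => by rw [← e] at hf; omega)
  have hSp : S p := (A.isotropic_iff.1 hy).1 p hpy
  have hMp : M ⊔ F ∙ p = y := by
    refine Submodule.eq_of_le_of_finrank_le
      (sup_le hMy ((Submodule.span_singleton_le_iff_mem _ _).2 hpy)) ?_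
    rw [hf, ← hM]
    refine Submodule.finrank_lt_finrank_of_lt (lt_of_le_of_ne le_sup_left fun e => hpM ?_)
    rw [e]
    exact Submodule.mem_sup_right (Submodule.mem_span_singleton_self p)
  have hperp : perpOf H M ⊓ LinearMap.ker (H p) = perpOf H y := by
    ext v
    constructor
    · rintro ⟨h1, h2⟩ w hw
      rw [← hMp] at hw
      obtain ⟨a, ha, b, hb, rfl⟩ := Submodule.mem_sup.1 hw
      obtain ⟨c, rfl⟩ := Submodule.mem_span_singleton.1 hb
      have h2 : H p v = 0 := h2
      rw [map_add, LinearMap.add_apply, h1 a ha, LinearMap.map_smulₛₗ, LinearMap.smul_apply, h2,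
        smul_zero, add_zero]
    · exact fun h => ⟨fun w hw => h w (hMy hw), h p hpy⟩
  have scale : ∀ W : Submodule F U, W ≤ perpOf H M → ¬ W ≤ perpOf H y → ∃ s ∈ W, H p s = 1 := by
    intro W h1 h2
    obtain ⟨s, hs, hs'⟩ := SetLike.not_le_iff_exists.1 h2
    have h3 : H p s ≠ 0 := fun h => hs' (hperp ▸ ⟨h1 hs, h⟩)
    exact ⟨(H p s)⁻¹ • s, W.smul_mem _ hs, by rw [map_smul, smul_eq_mul, inv_mul_cancel₀ h3]⟩
  have hperpy := A.finrank_perpOf hy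
  have hperpM := A.finrank_perpOf (A.mono hMy hy)
  have hpp : H p p = 0 := A.self hSp
  have hpMem : p ∈ perpOf H M := fun w hw => A.le_perp hy hpy w (hMy hw)
  -- the normalized vectors orthogonal to `M`
  have hB : Nat.card {s : U // s ∈ perpOf H M ∧ H p s = 1} =
      Nat.card F ^ finrank F (perpOf H y) := by
    obtain ⟨s₀, h1, h2⟩ := scale _ le_rfl fun h => by
      have := Submodule.finrank_mono h
      omega
    rw [natCard_affine h1 h2, hperp, Module.natCard_eq_pow_finrank (K := F)]
  -- double counting of the singular ones among them along the direction `p`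
  have hA : Nat.card {s : U // (s ∈ perpOf H M ∧ H p s = 1) ∧ S s} * Nat.card F =
      Nat.card {s : U // s ∈ perpOf H M ∧ H p s = 1} * τ := by
    have hmem : ∀ (s : U) (c : F), (s ∈ perpOf H M ∧ H p s = 1) →
        (s + c • p ∈ perpOf H M ∧ H p (s + c • p) = 1) := fun s c h =>
      ⟨Submodule.add_mem _ h.1 (Submodule.smul_mem _ c hpMem), by
        rw [map_add, map_smul, hpp, smul_zero, add_zero, h.2]⟩
    have e : ({s : U // (s ∈ perpOf H M ∧ H p s = 1) ∧ S s} × F) ≃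
        Σ s : {s : U // s ∈ perpOf H M ∧ H p s = 1}, {c : F // S (s.1 + c • p)} :=
      { toFun := fun a => ⟨⟨a.1.1 + (-a.2) • p, hmem _ _ a.1.2.1⟩, ⟨a.2, by
          have := a.1.2.2
          rwa [add_assoc, ← add_smul, neg_add_cancel, zero_smul, add_zero]⟩⟩
        invFun := fun a => (⟨a.1.1 + a.2.1 • p, hmem _ _ a.1.2, a.2.2⟩, a.2.1)
        left_inv := by
          rintro ⟨⟨s, hs⟩, c⟩
          simp only [Prod.mk.injEq, Subtype.mk.injEq, and_true]
          rw [add_assoc, ← add_smul, neg_add_cancel, zero_smul, add_zero]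
        right_inv := by
          rintro ⟨⟨s, hs⟩, ⟨c, hc⟩⟩
          have : s + c • p + (-c) • p = s := by
            rw [add_assoc, ← add_smul, add_neg_cancel, zero_smul, add_zero]
          refine Sigma.subtype_ext (Subtype.ext this) rfl }
    have hft : Fintype {s : U // s ∈ perpOf H M ∧ H p s = 1} := Fintype.ofFinite _
    rw [← Nat.card_prod, Nat.card_congr e, Nat.card_sigma,
      Finset.sum_congr rfl fun s _ => hτ p s.1 hSp s.2.2]
    simp
  -- every singular one spans together with `M` a unique maximal isotropic subspace
  have hN : Nat.card {s : U // (s ∈ perpOf H M ∧ H p s = 1) ∧ S s} =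
      Nat.card {w : Submodule F U // φ.IsIsotropic w ∧ finrank F w = D ∧ M ≤ w ∧ w ≠ y} *
        Nat.card F ^ finrank F M := by
    have hspan : ∀ s : U, s ∈ perpOf H M → H p s = 1 → S s →
        φ.IsIsotropic (M ⊔ F ∙ s) ∧ finrank F (M ⊔ F ∙ s : Submodule F U) = D ∧
          M ⊔ F ∙ s ≠ y := by
      intro s h1 h2 h3
      have hi : φ.IsIsotropic (M ⊔ F ∙ s) := A.sup (A.mono hMy hy) (A.span_singleton h3)
        (A.perp_symm ((Submodule.span_singleton_le_iff_mem _ _).2 h1))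
      have hs : s ∈ M ⊔ F ∙ s := Submodule.mem_sup_right (Submodule.mem_span_singleton_self s)
      refine ⟨hi, le_antisymm (hD _ hi) ?_, fun e => ?_⟩
      · rw [← hM]
        refine Submodule.finrank_lt_finrank_of_lt (lt_of_le_of_ne le_sup_left fun e => ?_)
        rw [← e] at hs
        have := A.le_perp hy (hMy hs) p hpy
        rw [h2] at this
        exact one_ne_zero this
      · rw [e] at hs
        have := A.le_perp hy hs p hpy
        rw [h2] at this
        exact one_ne_zero this
    have huniq : ∀ (w : Submodule F U) (s : U), finrank F w = D → M ≤ w → s ∈ w →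
        s ∈ perpOf H M → H p s = 1 → S s → M ⊔ F ∙ s = w := fun w s h1 h2 h3 h4 h5 h6 =>
      Submodule.eq_of_le_of_finrank_eq
        (sup_le h2 ((Submodule.span_singleton_le_iff_mem _ _).2 h3))
        ((hspan s h4 h5 h6).2.1.trans h1.symm)
    have e : {s : U // (s ∈ perpOf H M ∧ H p s = 1) ∧ S s} ≃
        Σ w : {w : Submodule F U // φ.IsIsotropic w ∧ finrank F w = D ∧ M ≤ w ∧ w ≠ y},
          {s : U // s ∈ w.1 ∧ H p s = 1} :=
      { toFun := fun s => ⟨⟨M ⊔ F ∙ s.1, (hspan s.1 s.2.1.1 s.2.1.2 s.2.2).1,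
            (hspan s.1 s.2.1.1 s.2.1.2 s.2.2).2.1, le_sup_left,
            (hspan s.1 s.2.1.1 s.2.1.2 s.2.2).2.2⟩,
          ⟨s.1, Submodule.mem_sup_right (Submodule.mem_span_singleton_self _), s.2.1.2⟩⟩
        invFun := fun a => ⟨a.2.1, ⟨fun m hm => A.le_perp a.1.2.1 a.2.2.1 m (a.1.2.2.2.1 hm),
          a.2.2.2⟩, (A.isotropic_iff.1 a.1.2.1).1 _ a.2.2.1⟩
        left_inv := fun s => rfl
        right_inv := by
          rintro ⟨⟨w, h1, h2, h3, h4⟩, ⟨s, h5, h6⟩⟩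
          refine Sigma.subtype_ext (Subtype.ext (huniq w s h2 h3 h5 ?_ h6 ?_)) rfl
          · exact fun m hm => A.le_perp h1 h5 m (h3 hm)
          · exact (A.isotropic_iff.1 h1).1 _ h5 }
    have hft : Fintype {w : Submodule F U //
      φ.IsIsotropic w ∧ finrank F w = D ∧ M ≤ w ∧ w ≠ y} := Fintype.ofFinite _
    have hfib : ∀ w : {w : Submodule F U //
        φ.IsIsotropic w ∧ finrank F w = D ∧ M ≤ w ∧ w ≠ y},
        Nat.card {s : U // s ∈ w.1 ∧ H p s = 1} = Nat.card F ^ finrank F M := by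
      rintro ⟨w, h1, h2, h3, h4⟩
      have hwM : w ≤ perpOf H M := (A.le_perp h1).trans fun v hv m hm => hv m (h3 hm)
      have hwy : ¬ w ≤ perpOf H y := by
        intro h
        have h5 := hD _ (A.sup h1 hy h)
        rw [← hf] at h5
        have h6 := Submodule.eq_of_le_of_finrank_le le_sup_right h5
        exact h4 (Submodule.eq_of_le_of_finrank_eq (h6 ▸ le_sup_left) (h2.trans hf.symm))
      obtain ⟨s₀, h5, h6⟩ := scale w hwM hwy
      rw [natCard_affine h5 h6, ← Module.natCard_eq_pow_finrank (K := F)]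
      have h7 : M = w ⊓ LinearMap.ker (H p) := by
        refine Submodule.eq_of_le_of_finrank_le
          (le_inf h3 fun m hm => A.le_perp hy (hMy hm) p hpy) ?_
        have h8 : w ⊓ LinearMap.ker (H p) < w := by
          refine lt_of_le_of_ne inf_le_left fun e => ?_
          have h9 : s₀ ∈ w ⊓ LinearMap.ker (H p) := e.symm ▸ h5
          have h9 : H p s₀ = 0 := h9.2
          rw [h6] at h9
          exact one_ne_zero h9
        have := Submodule.finrank_lt_finrank_of_lt h8
        omega
      rw [← h7]
    rw [Nat.card_congr e, Nat.card_sigma, Finset.sum_congr rfl fun w _ => hfib w]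
    simp
  rw [hN, hB] at hA
  have hD1 : Nat.card F ^ D = Nat.card F ^ finrank F M * Nat.card F := by rw [← hM, pow_succ]
  rw [two_mul, pow_add]
  nth_rw 1 [hD1]
  rw [← mul_assoc, ← mul_assoc, hA, mul_right_comm, ← pow_add, ← hf, hperpy]

theorem isPolar [Finite F] {D τ s k : ℕ} {W : Submodule F U} (hW : Maximal φ.IsIsotropic W)
    (hf : finrank F W = D)
    (hτ : ∀ p s : U, S p → H p s = 1 → Nat.card {c : F // S (s + c • p)} = τ)
    (hU : finrank F U = 2 * D + k) (hs : s = Nat.card F ^ k * τ) :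
    φ.IsPolar D s (perpOf H) where
  mono := A.mono
  le_perp_symm := A.perp_symm
  le_perp := A.le_perp
  sup := A.sup
  finrank_inf_perp := A.finrank_inf_perp
  finrank_le h := hf ▸ A.finrank_le_of_maximal hW h
  maximal_iff {W'} := by
    refine ⟨fun h => ⟨h.prop, le_antisymm (hf ▸ A.finrank_le_of_maximal hW h.prop)
      (hf ▸ A.finrank_le_of_maximal h hW.prop)⟩, fun h => ⟨h.1, fun V hV hle => ?_⟩⟩
    refine (Submodule.eq_of_le_of_finrank_le hle ?_).ge
    rw [h.2, ← hf]
    exact A.finrank_le_of_maximal hW hV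
  card_line {M y} hy hfy hMy hM := by
    have h := A.natCard_line (fun V hV => hf ▸ A.finrank_le_of_maximal hW hV) hτ hy hfy hMy hM
    rw [hU, pow_add, mul_assoc, ← hs, mul_comm] at h
    exact Nat.eq_of_mul_eq_mul_left (pow_pos Nat.card_pos _) h

end Form.IsReflexive

end Reflexive

/-! ### The matrix relations for a polar form. -/

section Polar

variable {F U : Type*} [Field F] [Finite F] [AddCommGroup U] [Module F U] [FiniteDimensional F U]
  {φ : Form F U}

theorem matK_eq (D : ℕ) (q : ℂ) (x : φ.Vertex) {s : ℕ} {perp : Submodule F U → Submodule F U}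
    (P : φ.IsPolar D s perp) : matK (φ.dualPolarGraph D) x D q =
      Matrix.diagonal fun y => q ^ (-2 * ((D : ℤ) - finrank F (y.1 ⊓ x.1 : Submodule F U))) := by
  classical
  ext y z
  rw [matK, Matrix.sum_apply]
  by_cases h : y = z
  · subst h
    simp only [Matrix.smul_apply, dualIdempotent, Matrix.diagonal_apply_eq, smul_eq_mul, mul_ite,
      mul_one, mul_zero]
    have h1 := (P.dist_add x y).2
    rw [Finset.sum_ite_eq, if_pos (Finset.mem_range.2 (by omega))]
    congr 2
    omega
  · simp [dualIdempotent, Matrix.diagonal_apply_ne _ h]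

theorem Form.IsPolar.main {D s : ℕ} {perp : Submodule F U → Submodule F U}
    (P : φ.IsPolar D s perp) (x : φ.Vertex) {q : ℂ} (hq : q ^ 2 = (Nat.card F : ℂ)) {e : ℕ}
    (hs : q ^ e = (s : ℂ)) :
    let Γ := φ.dualPolarGraph D
    let L := lowering Γ x
    let F₀ := flattening Γ x
    let R := raising Γ x
    let K := matK Γ x D q
    (K * L = q ^ 2 • (L * K) ∧ K * F₀ = F₀ * K ∧ K * R = q ^ (-2 : ℤ) • (R * K)) ∧
    (L * F₀ - q ^ 2 • (F₀ * L) = (q ^ e - 1) • L ∧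
      F₀ * R - q ^ 2 • (R * F₀) = (q ^ e - 1) • R) ∧
    ((q ^ 4 / (q ^ 2 + 1)) • (R * L ^ 2) - L * R * L
        + (q ^ (-2 : ℤ) / (q ^ 2 + 1)) • (L ^ 2 * R)
        = -(q ^ ((e : ℤ) + 2 * (D : ℤ) - 2)) • L ∧
      (q ^ 4 / (q ^ 2 + 1)) • (R ^ 2 * L) - R * L * R
        + (q ^ (-2 : ℤ) / (q ^ 2 + 1)) • (L * R ^ 2)
        = -(q ^ ((e : ℤ) + 2 * (D : ℤ) - 2)) • R) := by
  intro Γ L F₀ R K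
  have hb : (Nat.card F : ℂ) ≠ 0 := by
    have : Nat.card F ≠ 0 := Nat.card_pos.ne'
    exact_mod_cast this
  have hb1 : (Nat.card F : ℂ) + 1 ≠ 0 := by
    exact_mod_cast Nat.succ_ne_zero (Nat.card F)
  have hq0 : q ≠ 0 := by
    rintro rfl
    exact hb (by rw [← hq]; simp)
  have hL : L = ind (φ.Cov D x) := P.lowering_eq x
  have hF : F₀ = ind (φ.Flat D x) := P.flattening_eq x
  have hR : R = (ind (φ.Cov D x)).transpose := P.raising_eq x
  have hFt : F₀.transpose = F₀ := by
    rw [hF, ind_transpose]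
    congr 1
    funext y z
    exact propext ⟨fun h => ⟨h.1.symm, h.2.symm⟩, fun h => ⟨h.1.symm, h.2.symm⟩⟩
  have hLt : L.transpose = R := by rw [hL, hR]
  have hRt : R.transpose = L := by rw [hL, hR, Matrix.transpose_transpose]
  have hK : K = Matrix.diagonal fun y : φ.Vertex =>
    q ^ (-2 * ((D : ℤ) - finrank F (y.1 ⊓ x.1 : Submodule F U))) := matK_eq D q x P
  have hKt : K.transpose = K := by rw [hK, Matrix.diagonal_transpose]
  have hKL : K * L = q ^ 2 • (L * K) := by
    ext y z
    rw [Matrix.smul_apply, hK, Matrix.diagonal_mul, Matrix.mul_diagonal, hL, smul_eq_mul]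
    by_cases h : φ.Cov D x y z
    · rw [ind_of h, h.2, mul_one, one_mul, ← zpow_natCast q 2, ← zpow_add₀ hq0]
      congr 1
      push_cast
      ring
    · rw [ind_of_not h]; ring
  have hLF : L * F₀ - q ^ 2 • (F₀ * L) = (q ^ e - 1) • L := by
    ext y z
    rw [hL, hF, hq, hs]
    exact P.lowering_mul_flattening_apply x y z
  have hRL2 : (q ^ 4 / (q ^ 2 + 1)) • (R * L ^ 2) - L * R * L
        + (q ^ (-2 : ℤ) / (q ^ 2 + 1)) • (L ^ 2 * R)
        = -(q ^ ((e : ℤ) + 2 * (D : ℤ) - 2)) • L := by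
    have h1 : q ^ 4 = (Nat.card F : ℂ) ^ 2 := by rw [← hq]; ring
    have h2 : q ^ (-2 : ℤ) = (Nat.card F : ℂ)⁻¹ := by
      rw [zpow_neg, ← hq]; norm_cast
    have h3 : q ^ ((e : ℤ) + 2 * (D : ℤ) - 2) =
        (s : ℂ) * (Nat.card F : ℂ) ^ D / (Nat.card F : ℂ) := by
      rw [zpow_sub₀ hq0, zpow_add₀ hq0, zpow_mul, zpow_natCast, hs, ← hq]
      norm_cast
    have hc := P.traceRL_commutator x
    have hLR := P.lowering_mul_raising x
    rw [← hR, ← hL] at hLR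
    rw [← hL] at hc
    rw [h1, h2, h3, hq]
    have h4 : L * R * L = (Nat.card F : ℂ) • (R * L ^ 2) - (Nat.card F : ℂ) •
        (φ.traceRL D x * L) + Matrix.diagonal (φ.upDegree D x) * L := by
      rw [hLR, add_mul, smul_mul_assoc, sub_mul, smul_sub, mul_assoc, ← sq]
    have h5 : L ^ 2 * R = (Nat.card F : ℂ) • (L * R * L) - (Nat.card F : ℂ) •
        (L * φ.traceRL D x) + L * Matrix.diagonal (φ.upDegree D x) := by
      rw [mul_assoc L R L, sq, mul_assoc L L R, hLR, mul_add, mul_smul_comm, mul_sub, smul_sub]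
    -- The coefficient of `L R L` becomes `-1 + 1 / (b + 1) = -b / (b + 1)` with `b = |F|`, which
    -- makes the `R L²` terms cancel.
    rw [h5, h4]
    have hc' := congrArg (fun A => ((Nat.card F : ℂ) + 1)⁻¹ • A) hc
    have h6 : -((s : ℂ) * (Nat.card F : ℂ) ^ D / (Nat.card F : ℂ)) • L =
        ((Nat.card F : ℂ) + 1)⁻¹ •
          (-(((Nat.card F : ℂ) + 1) * s * (Nat.card F : ℂ) ^ D / Nat.card F) • L) := by
      rw [smul_smul]
      congr 1
      field_simp
    rw [h6, ← hc]
    ext y z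
    simp only [Matrix.add_apply, Matrix.sub_apply, Matrix.smul_apply, smul_eq_mul]
    field_simp
    ring
  refine ⟨⟨hKL, ?_, ?_⟩, ⟨hLF, ?_⟩, hRL2, ?_⟩
  · ext y z
    rw [hK, Matrix.diagonal_mul, Matrix.mul_diagonal, hF]
    by_cases h : φ.Flat D x y z
    · rw [ind_of h, h.2, mul_one, one_mul]
    · rw [ind_of_not h]; ring
  · have h := congrArg Matrix.transpose hKL
    rw [Matrix.transpose_smul, Matrix.transpose_mul, Matrix.transpose_mul, hKt, hLt] at h
    rw [h, smul_smul, zpow_neg]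
    norm_cast
    rw [inv_mul_cancel₀ (pow_ne_zero 2 hq0), one_smul]
  · have h := congrArg Matrix.transpose hLF
    simpa only [Matrix.transpose_smul, Matrix.transpose_mul, Matrix.transpose_sub, hFt, hLt]
      using h
  · have h := congrArg Matrix.transpose hRL2
    simpa only [Matrix.transpose_smul, Matrix.transpose_mul, Matrix.transpose_sub,
      Matrix.transpose_add, Matrix.transpose_pow, hLt, hRt, mul_assoc] using h

end Polar

/-! ### Trace and norm of an involution of a field. -/

section Involution

variable {F : Type*} [Field F] {σ : F →+* F}

theorem exists_involution_neg (hσ : ∀ a, σ (σ a) = a) (hne : σ ≠ RingHom.id F) :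
    ∃ ω : F, ω ≠ 0 ∧ σ ω = -ω := by
  obtain ⟨a, ha⟩ : ∃ a, σ a ≠ a := by
    by_contra! h
    exact hne (RingHom.ext h)
  exact ⟨a - σ a, sub_ne_zero.2 ha.symm, by rw [map_sub, hσ, neg_sub]⟩

theorem exists_involution_trace_eq_one (hσ : ∀ a, σ (σ a) = a) (hne : σ ≠ RingHom.id F) :
    ∃ c : F, c + σ c = 1 := by
  obtain ⟨c, hc⟩ : ∃ c, c + σ c ≠ 0 := by
    by_contra! h
    refine hne (RingHom.ext fun a => ?_)
    have h1 := h 1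
    rw [map_one] at h1
    have h2 := h a
    have h3 : a + a = 0 := by rw [← two_mul, ← one_add_one_eq_two, h1, zero_mul]
    rw [RingHom.id_apply]
    exact (add_left_cancel (h3.trans h2.symm)).symm
  refine ⟨c / (c + σ c), ?_⟩
  rw [map_div₀, map_add, hσ, add_comm (σ c) c, ← add_div, div_self hc]

/-- The elements `ω` and `c` form a basis of `F` over the fixed field; the coordinate along `c` is
the trace. -/
theorem natCard_involution (hσ : ∀ a, σ (σ a) = a) (hne : σ ≠ RingHom.id F) :
    Nat.card F = Nat.card {a : F // σ a = a} ^ 2 := by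
  obtain ⟨ω, hω, hω'⟩ := exists_involution_neg hσ hne
  obtain ⟨c, hc⟩ := exists_involution_trace_eq_one hσ hne
  have hfix : ∀ a : F, σ (a + σ a) = a + σ a := fun a => by rw [map_add, hσ, add_comm]
  rw [sq, ← Nat.card_prod]
  refine Nat.card_congr
    { toFun := fun a => (⟨(a - (a + σ a) * c) / ω, ?_⟩, ⟨a + σ a, hfix a⟩)
      invFun := fun f => f.1.1 * ω + f.2.1 * c
      left_inv := fun a => ?_
      right_inv := fun f => ?_ }
  · have h : σ c = 1 - c := eq_sub_of_add_eq' hc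
    rw [map_div₀, map_sub, map_mul, hfix, hω', h, div_neg, ← neg_div]
    congr 1
    ring
  · change (a - (a + σ a) * c) / ω * ω + (a + σ a) * c = a
    rw [div_mul_cancel₀ _ hω, sub_add_cancel]
  · obtain ⟨⟨f, hf⟩, ⟨g, hg⟩⟩ := f
    have h : f * ω + g * c + σ (f * ω + g * c) = g := by
      rw [map_add, map_mul, map_mul, hf, hg, hω']
      linear_combination g * hc
    refine Prod.ext (Subtype.ext ?_) (Subtype.ext h)
    change (f * ω + g * c - (f * ω + g * c + σ (f * ω + g * c)) * c) / ω = f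
    rw [h, add_sub_cancel_right, mul_div_cancel_right₀ _ hω]

/-- The solutions form a coset of `ω` times the fixed field, with `-a * c` as a particular solution.
-/
theorem natCard_involution_trace (hσ : ∀ a, σ (σ a) = a) (hne : σ ≠ RingHom.id F) {a : F}
    (ha : σ a = a) : Nat.card {c : F // a + (c + σ c) = 0} = Nat.card {a : F // σ a = a} := by
  obtain ⟨ω, hω, hω'⟩ := exists_involution_neg hσ hne
  obtain ⟨c, hc⟩ := exists_involution_trace_eq_one hσ hne
  have h : σ c = 1 - c := eq_sub_of_add_eq' hc
  refine Nat.card_congr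
    { toFun := fun d => ⟨(d.1 + a * c) / ω, ?_⟩
      invFun := fun f => ⟨f.1 * ω - a * c, ?_⟩
      left_inv := fun d => Subtype.ext ?_
      right_inv := fun f => Subtype.ext ?_ }
  · rw [map_div₀, map_add, map_mul, hω', h, ha, div_neg, ← neg_div]
    congr 1
    linear_combination -d.2
  · rw [map_sub, map_mul, map_mul, hω', h, ha, f.2]
    ring
  · change (d.1 + a * c) / ω * ω - a * c = d.1
    rw [div_mul_cancel₀ _ hω, add_sub_cancel_right]
  · change (f.1 * ω - a * c + a * c) / ω = f.1
    rw [sub_add_cancel, mul_div_cancel_right₀ _ hω]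

theorem exists_involution_norm_eq [Finite F] (hσ : ∀ a, σ (σ a) = a) (hne : σ ≠ RingHom.id F)
    {a : F} (ha : σ a = a) : ∃ c : F, c * σ c = a := by
  classical
  let K : Subfield F := RingHom.eqLocusField σ (RingHom.id F)
  have hK : ∀ c, c ∈ K ↔ σ c = c := fun c => Iff.rfl
  let τ : F ≃ₐ[K] F := AlgEquiv.ofRingEquiv (f := RingEquiv.ofRingHom σ σ (RingHom.ext hσ)
    (RingHom.ext hσ)) fun c => c.2
  have hτ : ∀ c, τ c = σ c := fun c => rfl
  have hτ1 : (1 : F ≃ₐ[K] F) ≠ τ := by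
    intro h
    refine hne (RingHom.ext fun c => ?_)
    rw [← hτ, ← h]
    rfl
  have hr : finrank K F = 2 := by
    have h1 := Module.natCard_eq_pow_finrank (K := K) (V := F)
    have h2 : Nat.card F = Nat.card K ^ 2 := natCard_involution hσ hne
    exact (Nat.pow_right_injective (Finite.one_lt_card (α := K)) (h2.symm.trans h1)).symm
  have huniv : ({1, τ} : Finset (F ≃ₐ[K] F)) = Finset.univ := by
    refine Finset.eq_univ_of_card _ ?_
    rw [Finset.card_pair hτ1, ← Nat.card_eq_fintype_card, IsGalois.card_aut_eq_finrank, hr]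
  obtain ⟨c, hc⟩ := FiniteField.norm_surjective K F ⟨a, ha⟩
  refine ⟨c, ?_⟩
  have h := Algebra.norm_eq_prod_automorphisms K c
  rw [hc, ← huniv, Finset.prod_pair hτ1] at h
  exact h.symm

end Involution

/-! ### The six types: Witt index and the value of `s`. -/

section Types

variable {F U : Type*} [Field F] [AddCommGroup U] [Module F U]

/-- Chevalley–Warning: a quadratic polynomial in at least three variables has a number of zeros
divisible by the characteristic, and the origin is one. -/
theorem exists_quadratic_eq_zero [Finite F] [FiniteDimensional F U] (Q : QuadraticForm F U)
    (A : Submodule F U) (hA : 3 ≤ finrank F A) : ∃ v ∈ A, v ≠ 0 ∧ Q v = 0 := by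
  classical
  have := Fintype.ofFinite F
  obtain ⟨B, rfl⟩ := LinearMap.BilinMap.toQuadraticMap_surjective Q
  let b := finBasis F A
  let f : MvPolynomial (Fin (finrank F A)) F := ∑ i, ∑ j,
    MvPolynomial.C (B (b i) (b j)) * (MvPolynomial.X i * MvPolynomial.X j)
  have hdeg : f.totalDegree ≤ 2 := by
    refine MvPolynomial.totalDegree_finsetSum_le fun i _ =>
      MvPolynomial.totalDegree_finsetSum_le fun j _ => ?_
    refine (MvPolynomial.totalDegree_mul _ _).trans ?_
    rw [MvPolynomial.totalDegree_C, zero_add]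
    refine (MvPolynomial.totalDegree_mul _ _).trans ?_
    rw [MvPolynomial.totalDegree_X, MvPolynomial.totalDegree_X]
  obtain ⟨p, hp⟩ := CharP.exists F
  have hprime : p.Prime := (CharP.char_is_prime_or_zero F p).resolve_right
    (CharP.char_ne_zero_of_finite F p)
  have hdvd := char_dvd_card_solutions p (f := f) (by rw [Fintype.card_fin]; omega)
  have h0 : MvPolynomial.eval (0 : Fin (finrank F A) → F) f = 0 := by
    simp [f]
  have hpos : 0 < Fintype.card {x : Fin (finrank F A) → F // MvPolynomial.eval x f = 0} :=
    Fintype.card_pos_iff.2 ⟨⟨0, h0⟩⟩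
  obtain ⟨⟨x, hx⟩, hx0⟩ := Fintype.exists_ne_of_one_lt_card
    (hprime.one_lt.trans_le (Nat.le_of_dvd hpos hdvd)) ⟨0, h0⟩
  refine ⟨(∑ i, x i • b i : A), Submodule.coe_mem _, ?_, ?_⟩
  · intro h
    have h1 : ∑ i, x i • b i = 0 := Subtype.ext h
    have h2 := Fintype.linearIndependent_iff.1 b.linearIndependent x h1
    exact hx0 (Subtype.ext (funext h2))
  · rw [LinearMap.BilinMap.toQuadraticMap_apply]
    rw [← hx]
    simp only [f, Submodule.coe_sum, Submodule.coe_smul, map_sum, LinearMap.sum_apply, map_smul,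
      LinearMap.smul_apply, smul_eq_mul, map_mul, MvPolynomial.eval_C, MvPolynomial.eval_X]
    rw [Finset.sum_comm]
    simp only [Finset.mul_sum]
    refine Finset.sum_congr rfl fun i _ => Finset.sum_congr rfl fun j _ => ?_
    ring

/-- Orthogonalise two basis vectors and choose the coefficient `c` by surjectivity of the norm onto
the fixed field. -/
theorem exists_hermitian_eq_zero [Finite F] [FiniteDimensional F U] {σ : F →+* F}
    (H : U →ₛₗ[σ] U →ₗ[F] F) (hσ : ∀ a, σ (σ a) = a) (hne : σ ≠ RingHom.id F)
    (hH : ∀ v w, σ (H v w) = H w v) (A : Submodule F U) (hA : 2 ≤ finrank F A) :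
    ∃ v ∈ A, v ≠ 0 ∧ H v v = 0 := by
  let b := finBasis F A
  let i : Fin (finrank F A) := ⟨0, by omega⟩
  let j : Fin (finrank F A) := ⟨1, by omega⟩
  have hij : i ≠ j := by simp [i, j]
  have hui : (b i : U) ≠ 0 := fun h => b.ne_zero i (Subtype.ext h)
  by_cases hα : H (b i) (b i) = 0
  · exact ⟨b i, (b i).2, hui, hα⟩
  obtain ⟨t, ht⟩ : ∃ t, t * H (b i) (b i) = H (b i) (b j) := ⟨_, div_mul_cancel₀ _ hα⟩
  have h1 : H (b i) (b j - t • b i : U) = 0 := by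
    rw [map_sub, map_smul, smul_eq_mul, ht, sub_self]
  have h2 : H (b j - t • b i : U) (b i) = 0 := by rw [← hH, h1, map_zero]
  obtain ⟨c, hc⟩ := exists_involution_norm_eq hσ hne
    (a := -H (b j - t • b i : U) (b j - t • b i : U) / H (b i) (b i)) (by
      rw [map_div₀, map_neg, hH, hH])
  refine ⟨c • b i + (b j - t • b i), ?_, fun h => ?_, ?_⟩
  · exact A.add_mem (A.smul_mem _ (b i).2) (A.sub_mem (b j).2 (A.smul_mem _ (b i).2))
  · have h3 : (c - t) • b i + (1 : F) • b j = 0 := by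
      refine Subtype.ext ?_
      rw [Submodule.coe_add, Submodule.coe_smul, Submodule.coe_smul, sub_smul, one_smul,
        Submodule.coe_zero, ← h]
      abel
    have h4 := congrArg (fun v => b.repr v j) h3
    simp [hij] at h4
  · generalize (b j - t • b i : U) = v at *
    have hc' := (eq_div_iff hα).1 hc
    simp only [map_add, LinearMap.add_apply, LinearMap.map_smulₛₗ, LinearMap.smul_apply, h1, h2,
      add_zero, smul_eq_mul, RingHom.id_apply]
    linear_combination hc'

theorem isReflexive_symplectic {β : U →ₗ[F] U →ₗ[F] F} (h : (Form.bilinear β).IsSymplectic) :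
    (Form.bilinear β).IsReflexive β fun _ => True where
  isotropic_iff := ⟨fun h => ⟨fun _ _ => trivial, h⟩, fun h => h.2⟩
  symm h' := h.1.isRefl _ _ h'
  add _ _ _ := trivial
  smul _ _ := trivial
  self _ := h.1 _
  eq_zero _ h' := h.2.1 _ h'

theorem isReflexive_quadratic {Q : QuadraticForm F U} (h : (Form.quadratic Q).IsQuadratic) :
    (Form.quadratic Q).IsReflexive Q.polarBilin fun v => Q v = 0 where
  isotropic_iff {W} := by
    refine ⟨fun h => ⟨h, fun v hv w hw => ?_⟩, fun h => h.1⟩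
    rw [QuadraticMap.polarBilin_apply_apply, QuadraticMap.polar, h _ (W.add_mem hv hw), h v hv,
      h w hw, sub_zero, sub_zero]
  symm {v w} h' := by
    rw [QuadraticMap.polarBilin_apply_apply] at h' ⊢
    rw [QuadraticMap.polar_comm, h']
  add {v w} h1 h2 h3 := by
    rw [QuadraticMap.polarBilin_apply_apply] at h3
    rw [QuadraticMap.map_add Q, h1, h2, h3, add_zero, add_zero]
  smul c h' := by rw [QuadraticMap.map_smul, h', smul_zero]
  self {v} h' := by
    rw [QuadraticMap.polarBilin_apply_apply, QuadraticMap.polar_self, h', smul_zero]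
  eq_zero {v} h1 h2 := by
    have h3 : v ∈ Q.radical := ⟨h1, LinearMap.ext h2⟩
    rw [h.radical_eq_bot] at h3
    exact h3

theorem isReflexive_hermitian {σ : F →+* F} {H : U →ₛₗ[σ] U →ₗ[F] F}
    (h : (Form.sesquilinear σ H).IsHermitian) :
    (Form.sesquilinear σ H).IsReflexive H fun v => H v v = 0 where
  isotropic_iff := ⟨fun h => ⟨fun w hw => h w hw w hw, h⟩, fun h => h.2⟩
  symm {v w} h' := by rw [← h.2.2.1, h', map_zero]
  add {v w} h1 h2 h3 := by
    have h4 : H w v = 0 := by rw [← h.2.2.1, h3, map_zero]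
    simp [h1, h2, h3, h4]
  smul c h' := by simp [h']
  self h' := h'
  eq_zero _ h' := h.2.2.2.1 _ h'

/-- Here `s = |F| ^ k * τ` with `dim U = 2D + k`; `τ` is `|F|` for symplectic, `1` for quadratic and
`q` for Hermitian forms. The Witt index is a hypothesis for `D` and `twoD`; for the other types the
dimension forces it. -/
theorem Form.HasType.exists_isPolar [Finite F] [FiniteDimensional F U] {φ : Form F U}
    {t : FormType} {D : ℕ} (h : φ.HasType t D) {q : ℂ} (hq : q ^ 2 = (Nat.card F : ℂ))
    (hqH : t.IsHermitian → ∃ r : ℕ, q = (r : ℂ)) (x : φ.Vertex) :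
    ∃ (s : ℕ) (perp : Submodule F U → Submodule F U), φ.IsPolar D s perp ∧
      q ^ t.twoE = (s : ℂ) := by
  obtain ⟨hdim, h⟩ := h
  have hx := x.2
  have quad : ∀ (Q : QuadraticForm F U) (p s : U), Q p = 0 → Q.polarBilin p s = 1 →
      Nat.card {c : F // Q (s + c • p) = 0} = 1 := by
    intro Q p s hp hps
    rw [← natCard_and_eq (p := fun _ : F => True) (a := -Q s) trivial]
    refine Nat.card_congr (Equiv.subtypeEquivRight fun c => ?_)
    rw [QuadraticMap.polarBilin_apply_apply] at hps
    rw [QuadraticMap.map_add Q, QuadraticMap.map_smul, hp, smul_zero, add_zero,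
      QuadraticMap.polar_smul_right, QuadraticMap.polar_comm, hps, smul_eq_mul, mul_one, true_and,
      eq_neg_iff_add_eq_zero, add_comm]
  have herm : ∀ {k : ℕ} {σ : F →+* F} {H : U →ₛₗ[σ] U →ₗ[F] F},
      (Form.sesquilinear σ H).IsHermitian → φ = Form.sesquilinear σ H → k ≤ 1 →
      finrank F U = 2 * D + k → t.IsHermitian → t.twoE = 2 * k + 1 →
      ∃ (s : ℕ) (perp : Submodule F U → Submodule F U), φ.IsPolar D s perp ∧
        q ^ t.twoE = (s : ℂ) := by
    rintro k σ H hH rfl hk hdim ht he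
    have A := isReflexive_hermitian hH
    have h1 := A.finrank_lt_of_maximal (exists_hermitian_eq_zero H hH.1 hH.2.1 hH.2.2.1) hx
    have h2 := A.finrank_perpOf hx.prop
    have h3 := Submodule.finrank_mono (A.le_perp hx.prop)
    obtain ⟨r, rfl⟩ := hqH ht
    -- The natural number `q` is the order of the fixed field; the sign of `q` matters because `2e`
    -- is odd here.
    have hr : Nat.card {a : F // σ a = a} = r := by
      have h4 := natCard_involution hH.1 hH.2.1
      have h5 : r ^ 2 = Nat.card F := by exact_mod_cast hq
      exact (Nat.pow_left_injective two_ne_zero (h5.trans h4)).symm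
    refine ⟨Nat.card F ^ k * r, _, A.isPolar hx (by omega) ?_ hdim rfl, ?_⟩
    · intro p s hp hps
      rw [← hr, ← natCard_involution_trace hH.1 hH.2.1 (hH.2.2.1 s s)]
      refine Nat.card_congr (Equiv.subtypeEquivRight fun c => ?_)
      have h4 : H s p = 1 := by rw [← hH.2.2.1, hps, map_one]
      have h5 : H (s + c • p) (s + c • p) = H s s + (c + σ c) := by
        simp [hp, hps, h4]
        ring
      rw [h5]
    · rw [he, pow_succ, pow_mul, hq]
      push_cast
      ring
  cases t with
  | C =>
    match φ, h with
    | .bilinear β, h =>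
      have A := isReflexive_symplectic h
      have hd : finrank F U = 2 * D := hdim
      have h1 := A.finrank_lt_of_maximal (k := 1) (fun B hB => by
        obtain ⟨v, hv⟩ := (finrank_pos_iff_exists_ne_zero (R := F) (M := B)).1 hB
        exact ⟨v, v.2, fun e => hv (Subtype.ext e), trivial⟩) hx
      have h2 := A.finrank_perpOf hx.prop
      have h3 := Submodule.finrank_mono (A.le_perp hx.prop)
      refine ⟨_, _, A.isPolar (k := 0) (τ := Nat.card F) hx (by omega) ?_ hd rfl, ?_⟩
      · intro p s _ _
        exact Nat.card_congr (Equiv.subtypeUnivEquiv fun _ => trivial)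
      · rw [pow_zero, one_mul, ← hq]
        rfl
  | B =>
    match φ, h with
    | .quadratic Q, h =>
      have A := isReflexive_quadratic h
      have hd : finrank F U = 2 * D + 1 := hdim
      have h1 := A.finrank_lt_of_maximal (exists_quadratic_eq_zero Q) hx
      have h2 := A.finrank_perpOf hx.prop
      have h3 := Submodule.finrank_mono (A.le_perp hx.prop)
      refine ⟨_, _, A.isPolar (k := 1) hx (by omega) (quad Q) hd rfl, ?_⟩
      rw [pow_one, mul_one, ← hq]
      rfl
  | D =>
    match φ, h with
    | .quadratic Q, h =>
      have A := isReflexive_quadratic h.1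
      obtain ⟨⟨W, hW, hWD⟩, hmax⟩ := h.2
      have h1 := A.finrank_le_of_maximal hx hW
      have h2 := hmax ⟨x.1, hx.prop, rfl⟩
      refine ⟨_, _, A.isPolar (k := 0) hx (by omega) (quad Q) hdim rfl, ?_⟩
      rw [pow_zero, mul_one, Nat.cast_one]
      exact pow_zero q
  | twoD =>
    match φ, h with
    | .quadratic Q, h =>
      have A := isReflexive_quadratic h.1
      obtain ⟨⟨W, hW, hWD⟩, hmax⟩ := h.2
      have h1 := A.finrank_le_of_maximal hx hW
      have h2 := hmax ⟨x.1, hx.prop, rfl⟩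
      refine ⟨_, _, A.isPolar (k := 2) hx (by omega) (quad Q) hdim rfl, ?_⟩
      rw [mul_one, Nat.cast_pow, ← hq, ← pow_mul]
      rfl
  | twoAEven =>
    cases φ with
    | sesquilinear σ H => exact herm h rfl le_rfl hdim (Or.inl rfl) rfl
    | bilinear => exact h.elim
    | quadratic => exact h.elim
  | twoAOdd =>
    cases φ with
    | sesquilinear σ H => exact herm h rfl zero_le_one hdim (Or.inr rfl) rfl
    | bilinear => exact h.elim
    | quadratic => exact h.elim

end Types

end DualPolar

theorem mainTheorem7 {F U : Type*} [Field F] [Finite F] [AddCommGroup U] [Module F U]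
    [FiniteDimensional F U] (t : DualPolar.FormType) (D : ℕ) (φ : DualPolar.Form F U)
    (hφ : φ.HasType t D) (q : ℂ) (hq : q ^ 2 = (Nat.card F : ℂ))
    (hqH : t.IsHermitian → ∃ r : ℕ, q = (r : ℂ)) (x : φ.Vertex) :
    let Γ := φ.dualPolarGraph D
    let L := DualPolar.lowering Γ x
    let F₀ := DualPolar.flattening Γ x
    let R := DualPolar.raising Γ x
    let K := DualPolar.matK Γ x D q
    (K * L = q ^ 2 • (L * K) ∧ K * F₀ = F₀ * K ∧ K * R = q ^ (-2 : ℤ) • (R * K)) ∧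
    (L * F₀ - q ^ 2 • (F₀ * L) = (q ^ t.twoE - 1) • L ∧
      F₀ * R - q ^ 2 • (R * F₀) = (q ^ t.twoE - 1) • R) ∧
    ((q ^ 4 / (q ^ 2 + 1)) • (R * L ^ 2) - L * R * L
        + (q ^ (-2 : ℤ) / (q ^ 2 + 1)) • (L ^ 2 * R)
        = -(q ^ ((t.twoE : ℤ) + 2 * (D : ℤ) - 2)) • L ∧
      (q ^ 4 / (q ^ 2 + 1)) • (R ^ 2 * L) - R * L * R
        + (q ^ (-2 : ℤ) / (q ^ 2 + 1)) • (L * R ^ 2)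
        = -(q ^ ((t.twoE : ℤ) + 2 * (D : ℤ) - 2)) • R) := by
  obtain ⟨s, perp, P, hs⟩ := hφ.exists_isPolar hq hqH x
  exact P.main x hq hs
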